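/- **Theorem 1 (Enhanced dissipation).** Let $\mathbb{T}=\mathbb{R}/\mathbb{Z}$, let $D=\mathbb{T}$ or $D=(0,1)$, and let $\Omega=\mathbb{T}\times D$. Let $b\in C^\infty(\bar D)$ be real-valued with precisely $M\ge 0$ critical points $y_1,\dots,y_M$ in $\bar D$ (end points of $[0,1]$ included, with one-sided derivatives there), and suppose that for each $i$ there is $N_i\in\mathbb{N}$ with $b^{(k)}(y_i)=0$ for all $1\le k\le N_i$ and $b^{(N_i+1)}(y_i)\ne 0$. Let $N=\max_{1\le i\le M}N_i$ if $M\ge1$, and $N=0$ if $M=0$. Then there exist $d_0,\nu_0>0$ and $C>1$, depending only on $b$ (and $D$), such that the following holds for all $\nu\in(0,\nu_0)$. Impose periodic conditions in $y$ if $D=\mathbb{T}$, and either homogeneous Dirichlet conditions or homogeneous Neumann conditions on $\{y=0,1\}$ if $D=(0,1)$. Let $f_{\rm in}\in C^\infty(\bar\Omega)$ be real-valued, satisfy these conditions, and have zero $x$-averages, $\int_{\mathbb{T}}f_{\rm in}(x,y)\,dx=0$ for all $y \in \bar D$. Let $f\in C([0,\infty);L^2(\Omega))\cap C^\infty(\bar\Omega\times(0,\infty))$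 be the real-valued solution of $$\partial_t f+b(y)\,\partial_x f-\nu\,\partial_{yy}f=0\quad\text{on }\Omega\times(0,\infty)$$ which satisfies the imposed conditions for all $t>0$ and $f(\cdot,0)=f_{\rm in}$. Then $$\|f(\cdot,t)\|_{L^2(\Omega)}\le C\,\|f_{\rm in}\|_{L^2(\Omega)}\exp\left(-d_0\,\nu^{\frac{N+1}{N+3}}\,t\right)\qquad\text{for all }t>0.$$ -/

import Mathlib

open Set Filter Topology MeasureTheory
open scoped ContDiff

namespace ShearFlow

/-- The cross-section `D` of the channel `Ω = 𝕋 × D`, `𝕋 = ℝ/ℤ`: the torus `𝕋` or the interval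
`(0,1)`. Functions on the torus are represented by `1`-periodic functions on `ℝ`. -/
inductive CrossSection where
  | torus
  | interval

/-- The open set of `y` on which the equation holds. -/
def CrossSection.domain : CrossSection → Set ℝ
  | .torus => univ
  | .interval => Ioo 0 1

/-- The set of `y` representing the closure of `D`. -/
def CrossSection.closure : CrossSection → Set ℝ
  | .torus => univ
  | .interval => Icc 0 1

/-- A set containing exactly one representative of every point of the closure of `D`. -/
def CrossSection.cell : CrossSection → Set ℝ
  | .torus => Ico 0 1
  | .interval => Icc 0 1

/-- The condition that a function of `y` lives on `D`: it is `1`-periodic when `D = 𝕋`. -/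
def CrossSection.Descends : CrossSection → (ℝ → ℝ) → Prop
  | .torus, g => Function.Periodic g 1
  | .interval, _ => True

/-- `b ∈ C^∞` on the closure of `D` (derivatives at the end points of `[0,1]` are one-sided). -/
structure IsSmoothProfile (D : CrossSection) (b : ℝ → ℝ) : Prop where
  smooth : ContDiffOn ℝ ∞ b D.closure
  descends : D.Descends b

/-- The critical points of `b` in the closure of `D`, end points included. -/
def criticalPoints (D : CrossSection) (b : ℝ → ℝ) : Set ℝ :=
  {y | y ∈ D.cell ∧ derivWithin b D.closure y = 0}

/-- `b^{(k)}(y) = 0` for `1 ≤ k ≤ n` and `b^{(n+1)}(y) ≠ 0`. -/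
def VanishesToOrder (D : CrossSection) (b : ℝ → ℝ) (y : ℝ) (n : ℕ) : Prop :=
  (∀ k : ℕ, 1 ≤ k → k ≤ n → iteratedDerivWithin k b D.closure y = 0) ∧
    iteratedDerivWithin (n + 1) b D.closure y ≠ 0

/-- Boundary conditions in `y`: periodic on the torus, homogeneous Dirichlet or homogeneous
Neumann on the interval. -/
inductive BoundaryCondition : CrossSection → Type where
  | periodic : BoundaryCondition .torus
  | dirichlet : BoundaryCondition .interval
  | neumann : BoundaryCondition .interval

/-- The function `g` of `y` satisfies the boundary condition. -/
def BoundaryCondition.Holds : {D : CrossSection} → BoundaryCondition D → (ℝ → ℝ) → Prop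
  | _, .periodic, g => Function.Periodic g 1
  | _, .dirichlet, g => g 0 = 0 ∧ g 1 = 0
  | _, .neumann, g => derivWithin g (Icc 0 1) 0 = 0 ∧ derivWithin g (Icc 0 1) 1 = 0

/-- Lebesgue measure on `Ω = 𝕋 × D`, realised on the unit square. -/
noncomputable def volΩ : Measure (ℝ × ℝ) :=
  volume.restrict (Ioo (0 : ℝ) 1 ×ˢ Ioo (0 : ℝ) 1)

/-- The `L²(Ω)` norm of a function `g` of `(x, y)`. -/
noncomputable def normL2 (g : ℝ → ℝ → ℝ) : ENNReal :=
  eLpNorm (fun p : ℝ × ℝ => g p.1 p.2) 2 volΩ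

/-- Admissible initial data: smooth up to the boundary of `Ω`, periodic in `x`, satisfying the
boundary condition in `y`, with vanishing `x`-averages. -/
structure IsInitialDatum {D : CrossSection} (bc : BoundaryCondition D) (g : ℝ → ℝ → ℝ) : Prop where
  smooth : ContDiffOn ℝ ∞ (fun p : ℝ × ℝ => g p.1 p.2) (univ ×ˢ D.closure)
  periodic_x : ∀ y ∈ D.closure, Function.Periodic (fun x => g x y) 1
  boundary : ∀ x, bc.Holds (g x)
  mean_zero : ∀ y ∈ D.closure, ∫ x in (0 : ℝ)..1, g x y = 0

/-- `f t x y` is a smooth solution, in `C([0,∞); L²(Ω)) ∩ C^∞` up to the boundary of `Ω` for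
`t > 0`, of `∂_t f + b(y) ∂_x f - ν ∂_yy f = 0` with initial datum `g` and boundary condition
`bc`. -/
structure IsSolution {D : CrossSection} (bc : BoundaryCondition D) (b : ℝ → ℝ) (ν : ℝ)
    (g : ℝ → ℝ → ℝ) (f : ℝ → ℝ → ℝ → ℝ) : Prop where
  smooth : ContDiffOn ℝ ∞ (fun p : ℝ × ℝ × ℝ => f p.1 p.2.1 p.2.2)
    (Ioi 0 ×ˢ (univ ×ˢ D.closure))
  periodic_x : ∀ t > 0, ∀ y ∈ D.closure, Function.Periodic (fun x => f t x y) 1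
  boundary : ∀ t > 0, ∀ x, bc.Holds (f t x)
  equation : ∀ t > 0, ∀ x, ∀ y ∈ D.domain,
    deriv (fun s => f s x y) t + b y * deriv (fun z => f t z y) x
      - ν * iteratedDeriv 2 (fun z => f t x z) y = 0
  memLp : ∀ t ≥ 0, MemLp (fun p : ℝ × ℝ => f t p.1 p.2) 2 volΩ
  continuous_L2 : ∀ t ≥ 0,
    Tendsto (fun s => normL2 (fun x y => f s x y - f t x y)) (𝓝[Ici 0] t) (𝓝 0)
  initial : (fun p : ℝ × ℝ => f 0 p.1 p.2) =ᵐ[volΩ] fun p => g p.1 p.2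

end ShearFlow

/-!
# Enhanced dissipation for shear flows

Expanding in a Fourier series in `x`, the mode `g` of wave number `k` solves the one-dimensional
equation `∂_t g + i α b(y) g = ν ∂_yy g` with `α = 2πk`. Its energy `∫ |g|² dy` never increases, so
the mode `k = 0`, which starts from zero, vanishes. The theorem is the decay of the other modes at a
rate proportional to `ν^((N+1)/(N+3))`, uniformly in `k`, summed by Parseval's identity.

The decay comes from a lower bound on the resolvent, uniform in the spectral parameter
(`exists_resolvent_estimate`): with `δ = ν^(1/(N+3))` and `r = δ^(N+1) = ν^((N+1)/(N+3))`,

  `‖i α (b - λ) F - ν F''‖ ≥ ε r ‖F‖`  in `L²(0,1)`.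

Write `u_0 = b - λ`, `u_j = δ^j b^{(j)}`, `w² = ∑_{j ≤ N+1} u_j²` and `χ_j = u_j / w`. Every point of
the cross-section has a nonzero derivative of `b` of order between `1` and `N + 1`, so `w ≥ c r`, and
since `δ u_j' = u_{j+1}`, each `χ_j` varies on the length scale `δ`. If the left-hand side, `G`, is
small compared to `r ‖F‖`, then pairing it with `F` shows that `δ ‖F'‖` is small compared to `‖F‖`,
and pairing it with `χ_0 F` shows that `‖χ_0 F‖` is small, because `(b - λ) χ_0 = w χ_0² ≥ c r χ_0²`.
The identity `χ_{j+1} = δ χ_j' + (bounded) χ_j`, a commutator of `δ ∂_y` with `χ_j`, carries the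
smallness from `χ_j F` to `χ_{j+1} F` (`commutator_step`). After `N + 1` steps all the `χ_j F` are
small, which contradicts `∑ χ_j² = 1`. The boundary conditions enter only through the vanishing of
`[F' \bar F]` and `[χ_0 F' \bar F]`; the boundary terms of the commutator step are bounded by a trace
inequality.

To pass from the resolvent to the evolution (`IsModeSolution.energy_decay`), localise `g` in time by
`φ(t) = (t - a)(b - t)` and expand `φ g` in a Fourier series on `[a, b]`. Each coefficient solves the
resolvent equation with right-hand side the coefficient of `φ' g`, so Parseval's identity and the
monotonicity of the energy `E` give `(ε r)² E(b) ∫ φ² ≤ E(a) ∫ φ'²`, that is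
`(ε r (b - a))² E(b) ≤ 10 E(a)`: the energy drops by a fixed factor over a time of order `1 / r`.
-/

namespace ShearFlow

/-! ### Integrals over the unit interval, and the iteration lemma -/

theorem integral_eq_sub_of_hasDerivWithinAt_Icc {E : Type*} [NormedAddCommGroup E]
    [NormedSpace ℝ E] [CompleteSpace E] {a b : ℝ} (hab : a ≤ b) {f f' : ℝ → E}
    (hf : ∀ y ∈ Icc a b, HasDerivWithinAt f (f' y) (Icc a b) y)
    (hf' : ContinuousOn f' (Icc a b)) : ∫ y in a..b, f' y = f b - f a := by
  refine intervalIntegral.integral_eq_sub_of_hasDerivAt_of_le hab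
    (fun y hy => (hf y hy).continuousWithinAt)
    (fun y hy => (hf y (Ioo_subset_Icc_self hy)).hasDerivAt (Icc_mem_nhds hy.1 hy.2)) ?_
  exact ContinuousOn.intervalIntegrable (by rwa [uIcc_of_le hab])

theorem intervalIntegrable_of_continuousOn {E : Type*} [NormedAddCommGroup E]
    {f : ℝ → E} (hf : ContinuousOn f (Icc (0 : ℝ) 1)) : IntervalIntegrable f volume 0 1 :=
  ContinuousOn.intervalIntegrable (by rwa [uIcc_of_le zero_le_one])

theorem integral_le_integral_of_continuousOn {f g : ℝ → ℝ} (hf : ContinuousOn f (Icc (0 : ℝ) 1))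
    (hg : ContinuousOn g (Icc (0 : ℝ) 1)) (h : ∀ y ∈ Icc (0 : ℝ) 1, f y ≤ g y) :
    ∫ y in (0 : ℝ)..1, f y ≤ ∫ y in (0 : ℝ)..1, g y :=
  intervalIntegral.integral_mono_on zero_le_one (intervalIntegrable_of_continuousOn hf)
    (intervalIntegrable_of_continuousOn hg) h

theorem integral_linear_combination {f g : ℝ → ℝ} (a b : ℝ)
    (hf : ContinuousOn f (Icc (0 : ℝ) 1)) (hg : ContinuousOn g (Icc (0 : ℝ) 1)) :
    ∫ y in (0 : ℝ)..1, (a * f y + b * g y) =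
      a * (∫ y in (0 : ℝ)..1, f y) + b * ∫ y in (0 : ℝ)..1, g y := by
  rw [intervalIntegral.integral_add ((intervalIntegrable_of_continuousOn hf).const_mul a)
    ((intervalIntegrable_of_continuousOn hg).const_mul b),
    intervalIntegral.integral_const_mul, intervalIntegral.integral_const_mul]

/-- The Cauchy–Schwarz inequality. -/
theorem integral_abs_mul_abs_le_sqrt {f g : ℝ → ℝ} (hf : ContinuousOn f (Icc (0 : ℝ) 1))
    (hg : ContinuousOn g (Icc (0 : ℝ) 1)) :
    ∫ y in (0 : ℝ)..1, |f y| * |g y| ≤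
      √(∫ y in (0 : ℝ)..1, f y ^ 2) * √(∫ y in (0 : ℝ)..1, g y ^ 2) := by
  have hff : IntervalIntegrable (fun y => f y ^ 2) volume 0 1 :=
    intervalIntegrable_of_continuousOn (hf.pow 2)
  have hgg : IntervalIntegrable (fun y => g y ^ 2) volume 0 1 :=
    intervalIntegrable_of_continuousOn (hg.pow 2)
  have hfg : IntervalIntegrable (fun y => |f y| * |g y|) volume 0 1 :=
    intervalIntegrable_of_continuousOn (hf.abs.mul hg.abs)
  have hA : 0 ≤ ∫ y in (0 : ℝ)..1, f y ^ 2 :=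
    intervalIntegral.integral_nonneg zero_le_one fun y _ => sq_nonneg _
  have hB : 0 ≤ ∫ y in (0 : ℝ)..1, g y ^ 2 :=
    intervalIntegral.integral_nonneg zero_le_one fun y _ => sq_nonneg _
  rw [← Real.sqrt_mul hA]
  refine Real.le_sqrt_of_sq_le ?_
  have key : ∀ s : ℝ, 0 ≤ (∫ y in (0 : ℝ)..1, g y ^ 2) * (s * s) +
      (2 * ∫ y in (0 : ℝ)..1, |f y| * |g y|) * s + ∫ y in (0 : ℝ)..1, f y ^ 2 := by
    intro s
    have : (∫ y in (0 : ℝ)..1, g y ^ 2) * (s * s) +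
      (2 * ∫ y in (0 : ℝ)..1, |f y| * |g y|) * s + ∫ y in (0 : ℝ)..1, f y ^ 2 =
      ∫ y in (0 : ℝ)..1, (g y ^ 2 * (s * s) + (|f y| * |g y|) * (2 * s) + f y ^ 2) := by
      rw [intervalIntegral.integral_add ((hgg.mul_const _).add (hfg.mul_const _)) hff,
        intervalIntegral.integral_add (hgg.mul_const _) (hfg.mul_const _),
        intervalIntegral.integral_mul_const, intervalIntegral.integral_mul_const]
      ring
    rw [this]
    refine intervalIntegral.integral_nonneg zero_le_one fun y _ => ?_
    rw [← sq_abs (f y), ← sq_abs (g y)]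
    nlinarith [sq_nonneg (|f y| + s * |g y|)]
  have := discrim_le_zero key
  rw [discrim] at this
  nlinarith

/-- The iteration behind the lower bound for `α 0`: a small `α 0` forces all `α j` to be small,
which is impossible when their squares add up to one. -/
theorem exists_le_of_sq_succ_le_sqrt (K : ℝ) (m : ℕ) :
    ∃ η > 0, ∀ α : ℕ → ℝ, (∀ j, 0 ≤ α j) → (∀ j < m, α (j + 1) ^ 2 ≤ K * √(α j)) →
      ∑ j ∈ Finset.range (m + 1), α j ^ 2 = 1 → η ≤ α 0 := by
  have step : ∀ k : ℕ, ∀ τ > 0, ∃ η > 0, ∀ α : ℕ → ℝ, (∀ j, 0 ≤ α j) →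
      (∀ j < k, α (j + 1) ^ 2 ≤ K * √(α j)) → α 0 < η → ∀ j ≤ k, α j < τ := by
    intro k
    induction k with
    | zero =>
      intro τ hτ
      refine ⟨τ, hτ, fun α _ _ h j hj => ?_⟩
      obtain rfl : j = 0 := by omega
      exact h
    | succ k ih =>
      intro τ hτ
      have hK : 0 < |K| + 1 := by positivity
      obtain ⟨η, hη, H⟩ := ih (min τ ((τ ^ 2 / (|K| + 1)) ^ 2)) (by positivity)
      refine ⟨η, hη, fun α h0 hs hα j hj => ?_⟩
      have H' := H α h0 (fun j hj => hs j (by omega)) hα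
      rcases Nat.lt_or_ge j (k + 1) with hjk | hjk
      · exact (H' j (by omega)).trans_le (min_le_left _ _)
      · obtain rfl : j = k + 1 := by omega
        have h1 : α k < (τ ^ 2 / (|K| + 1)) ^ 2 := (H' k le_rfl).trans_le (min_le_right _ _)
        have h2 : √(α k) < τ ^ 2 / (|K| + 1) := by
          rw [Real.sqrt_lt' (by positivity)]; exact h1
        have h3 := hs k (by omega)
        have h4 : (|K| + 1) * √(α k) < τ ^ 2 := by
          rw [lt_div_iff₀ hK] at h2; linarith
        have h5 : K * √(α k) ≤ (|K| + 1) * √(α k) := by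
          gcongr
          linarith [le_abs_self K]
        exact lt_of_pow_lt_pow_left₀ 2 hτ.le (by linarith)
  obtain ⟨η, hη, H⟩ := step m (1 / (m + 1)) (by positivity)
  refine ⟨η, hη, fun α h0 hs h1 => ?_⟩
  by_contra! hlt
  have H' := H α h0 hs hlt
  have : ∑ j ∈ Finset.range (m + 1), α j ^ 2 <
      ∑ j ∈ Finset.range (m + 1), (1 / ((m : ℝ) + 1)) := by
    refine Finset.sum_lt_sum_of_nonempty (by simp) fun j hj => ?_
    have h2 := H' j (by simpa [Nat.lt_succ_iff] using hj)
    have h3 : 1 / ((m : ℝ) + 1) ≤ 1 := by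
      rw [div_le_one (by positivity)]; linarith [(Nat.cast_nonneg m : (0 : ℝ) ≤ m)]
    nlinarith [h0 j]
  rw [h1, Finset.sum_const, Finset.card_range, nsmul_eq_mul] at this
  push_cast at this
  rw [mul_one_div_cancel (by positivity)] at this
  exact lt_irrefl _ this

/-! ### The commutator step -/

/-- The one-dimensional trace inequality. -/
theorem abs_endpoint_le_integral {σ σ' : ℝ → ℝ}
    (hσ : ∀ y ∈ Icc (0 : ℝ) 1, HasDerivWithinAt σ (σ' y) (Icc 0 1) y)
    (hσ' : ContinuousOn σ' (Icc 0 1)) :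
    |σ 0| ≤ ∫ y in (0 : ℝ)..1, (|σ y| + |σ' y|) ∧
      |σ 1| ≤ ∫ y in (0 : ℝ)..1, (|σ y| + |σ' y|) := by
  have hc : ContinuousOn σ (Icc 0 1) := fun y hy => (hσ y hy).continuousWithinAt
  -- The endpoint values are `∫ ((y - a) σ)'` with `a` the opposite endpoint.
  have key : ∀ a ∈ Icc (0 : ℝ) 1, |(1 - a) * σ 1 - (0 - a) * σ 0| ≤
      ∫ y in (0 : ℝ)..1, (|σ y| + |σ' y|) := by
    intro a ha
    have h := integral_eq_sub_of_hasDerivWithinAt_Icc zero_le_one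
      (f := fun y => (y - a) * σ y) (f' := fun y => 1 * σ y + (y - a) * σ' y)
      (fun y hy => (((hasDerivAt_id y).sub_const a).hasDerivWithinAt).mul (hσ y hy))
      (by fun_prop)
    rw [← h]
    refine (intervalIntegral.abs_integral_le_integral_abs zero_le_one).trans ?_
    refine integral_le_integral_of_continuousOn (by fun_prop) (by fun_prop)
      fun y hy => ?_
    have h1 : |y - a| ≤ 1 := by
      rw [abs_le]; constructor <;> linarith [hy.1, hy.2, ha.1, ha.2]
    calc |1 * σ y + (y - a) * σ' y| ≤ |1 * σ y| + |(y - a) * σ' y| := abs_add_le _ _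
      _ = |σ y| + |y - a| * |σ' y| := by rw [one_mul, abs_mul]
      _ ≤ |σ y| + 1 * |σ' y| := by gcongr
      _ = _ := by rw [one_mul]
  constructor
  · simpa using key 1 (by simp)
  · simpa using key 0 (by simp)

theorem hasDerivWithinAt_norm_sq {F F1 : ℝ → ℂ} {s : Set ℝ} {y : ℝ}
    (hF : HasDerivWithinAt F (F1 y) s y) :
    HasDerivWithinAt (fun y => ‖F y‖ ^ 2) (2 * inner ℝ (F y) (F1 y)) s y := hF.norm_sq

/-- One step of the commutator chain: since `δ p' = q` up to a multiple of `p`, the weight `q` is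
controlled by the weight `p`, at the cost of a power. The exponents are those produced by the
boundary terms, so that no boundary condition is needed. -/
theorem commutator_step {C δ : ℝ} (hC : 0 ≤ C) (hδ : 0 < δ) (hδ1 : δ ≤ 1)
    {p q p' q' κ : ℝ → ℝ} {F F1 : ℝ → ℂ}
    (hp : ∀ y ∈ Icc (0 : ℝ) 1, HasDerivWithinAt p (p' y) (Icc 0 1) y)
    (hq : ∀ y ∈ Icc (0 : ℝ) 1, HasDerivWithinAt q (q' y) (Icc 0 1) y)
    (hF : ∀ y ∈ Icc (0 : ℝ) 1, HasDerivWithinAt F (F1 y) (Icc 0 1) y)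
    (cp' : ContinuousOn p' (Icc 0 1)) (cq' : ContinuousOn q' (Icc 0 1))
    (cF1 : ContinuousOn F1 (Icc 0 1))
    (hpq : ∀ y ∈ Icc (0 : ℝ) 1, δ * p' y = q y - κ y * p y)
    (hκ : ∀ y ∈ Icc (0 : ℝ) 1, |κ y| ≤ C)
    (hp1 : ∀ y ∈ Icc (0 : ℝ) 1, |p y| ≤ 1) (hq1 : ∀ y ∈ Icc (0 : ℝ) 1, |q y| ≤ 1)
    (hp'C : ∀ y ∈ Icc (0 : ℝ) 1, δ * |p' y| ≤ C) (hq'C : ∀ y ∈ Icc (0 : ℝ) 1, δ * |q' y| ≤ C)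
    (hFF : δ * √(∫ y in (0 : ℝ)..1, ‖F1 y‖ ^ 2) ≤ √(∫ y in (0 : ℝ)..1, ‖F y‖ ^ 2)) :
    ∫ y in (0 : ℝ)..1, (q y * ‖F y‖) ^ 2 ≤ (2 * C + 2 + 2 * √(6 * C + 9)) *
      √(√(∫ y in (0 : ℝ)..1, (p y * ‖F y‖) ^ 2) * √(∫ y in (0 : ℝ)..1, ‖F y‖ ^ 2) ^ 3) := by
  have cp : ContinuousOn p (Icc 0 1) := fun y hy => (hp y hy).continuousWithinAt
  have cq : ContinuousOn q (Icc 0 1) := fun y hy => (hq y hy).continuousWithinAt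
  have cF : ContinuousOn F (Icc 0 1) := fun y hy => (hF y hy).continuousWithinAt
  set n := √(∫ y in (0 : ℝ)..1, ‖F y‖ ^ 2) with hn
  set A := √(∫ y in (0 : ℝ)..1, (p y * ‖F y‖) ^ 2) with hA
  have hn0 : 0 ≤ n := Real.sqrt_nonneg _
  have hA0 : 0 ≤ A := Real.sqrt_nonneg _
  have hAn : A ≤ n := by
    refine Real.sqrt_le_sqrt (integral_le_integral_of_continuousOn (by fun_prop) (by fun_prop)
      fun y hy => ?_)
    rw [mul_pow, ← sq_abs (p y)]
    have := pow_le_one₀ (n := 2) (abs_nonneg _) (hp1 y hy)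
    nlinarith [sq_nonneg ‖F y‖]
  have hδF1 : √(∫ y in (0 : ℝ)..1, (δ * ‖F1 y‖) ^ 2) ≤ n := by
    have : ∀ y, (δ * ‖F1 y‖) ^ 2 = δ ^ 2 * ‖F1 y‖ ^ 2 := fun y => by ring
    simp only [this]
    rwa [intervalIntegral.integral_const_mul, Real.sqrt_mul (by positivity), Real.sqrt_sq hδ.le]
  have cs1 : ∫ y in (0 : ℝ)..1, |p y * ‖F y‖| * |‖F y‖| ≤ A * n :=
    integral_abs_mul_abs_le_sqrt (by fun_prop) (by fun_prop)
  have cs2 : ∫ y in (0 : ℝ)..1, |p y * ‖F y‖| * |δ * ‖F1 y‖| ≤ A * n :=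
    (integral_abs_mul_abs_le_sqrt (by fun_prop) (by fun_prop)).trans (by gcongr)
  have cs3 : ∫ y in (0 : ℝ)..1, |‖F y‖| * |‖F y‖| ≤ n * n :=
    integral_abs_mul_abs_le_sqrt (by fun_prop) (by fun_prop)
  have cs4 : ∫ y in (0 : ℝ)..1, |‖F y‖| * |δ * ‖F1 y‖| ≤ n * n :=
    (integral_abs_mul_abs_le_sqrt (by fun_prop) (by fun_prop)).trans (by gcongr)
  set ρ : ℝ → ℝ := fun y => ‖F y‖ ^ 2 with hρ
  set ρ' : ℝ → ℝ := fun y => 2 * inner ℝ (F y) (F1 y) with hρ'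
  have dρ : ∀ y ∈ Icc (0 : ℝ) 1, HasDerivWithinAt ρ (ρ' y) (Icc 0 1) y :=
    fun y hy => hasDerivWithinAt_norm_sq (hF y hy)
  have cρ : ContinuousOn ρ (Icc 0 1) := fun y hy => (dρ y hy).continuousWithinAt
  have cρ' : ContinuousOn ρ' (Icc 0 1) := continuousOn_const.mul (cF.inner cF1)
  have bρ' : ∀ y, |ρ' y| ≤ 2 * (‖F y‖ * ‖F1 y‖) := by
    intro y
    rw [hρ', abs_mul, abs_two]
    have := abs_real_inner_le_norm (F y) (F1 y)
    linarith
  have ρ0 : ∀ y, 0 ≤ ρ y := fun y => sq_nonneg _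
  -- bounds for the endpoint values of `δ ρ` and `δ p² ρ`, through the trace inequality
  have tr1 : δ * ∫ y in (0 : ℝ)..1, (|ρ y| + |ρ' y|) ≤ 3 * n ^ 2 := by
    have : δ * ∫ y in (0 : ℝ)..1, (|ρ y| + |ρ' y|) ≤
        ∫ y in (0 : ℝ)..1, (1 * (|‖F y‖| * |‖F y‖|) + 2 * (|‖F y‖| * |δ * ‖F1 y‖|)) := by
      rw [← intervalIntegral.integral_const_mul]
      refine integral_le_integral_of_continuousOn (by fun_prop) (by fun_prop)
        fun y hy => ?_
      rw [abs_of_nonneg (ρ0 y), abs_norm, abs_mul δ, abs_of_pos hδ, abs_norm]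
      have := mul_le_mul_of_nonneg_left (bρ' y) hδ.le
      simp only [hρ]
      nlinarith [sq_nonneg ‖F y‖]
    rw [integral_linear_combination _ _ (by fun_prop) (by fun_prop)] at this
    nlinarith
  set σ : ℝ → ℝ := fun y => p y ^ 2 * ρ y with hσ
  set σ' : ℝ → ℝ := fun y => (2 * p y * p' y) * ρ y + p y ^ 2 * ρ' y with hσ'
  have dσ : ∀ y ∈ Icc (0 : ℝ) 1, HasDerivWithinAt σ (σ' y) (Icc 0 1) y := by
    intro y hy
    have := ((hp y hy).pow 2).mul (dρ y hy)
    refine this.congr_deriv ?_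
    simp [hσ']
  have cσ' : ContinuousOn σ' (Icc 0 1) := by fun_prop
  have cσ : ContinuousOn σ (Icc 0 1) := by fun_prop
  have tr2 : δ * ∫ y in (0 : ℝ)..1, (|σ y| + |σ' y|) ≤ (2 * C + 3) * (A * n) := by
    have : δ * ∫ y in (0 : ℝ)..1, (|σ y| + |σ' y|) ≤
        ∫ y in (0 : ℝ)..1, ((2 * C + 1) * (|p y * ‖F y‖| * |‖F y‖|) +
          2 * (|p y * ‖F y‖| * |δ * ‖F1 y‖|)) := by
      rw [← intervalIntegral.integral_const_mul]
      refine integral_le_integral_of_continuousOn (by fun_prop) (by fun_prop)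
        fun y hy => ?_
      have h1 : |σ y| ≤ |p y| * ‖F y‖ ^ 2 := by
        rw [hσ, abs_mul, abs_of_nonneg (ρ0 y), abs_pow]
        have := hp1 y hy
        gcongr
        nlinarith [abs_nonneg (p y)]
      have h2 : |σ' y| ≤ 2 * |p y| * |p' y| * ‖F y‖ ^ 2 + |p y| * (2 * (‖F y‖ * ‖F1 y‖)) := by
        refine (abs_add_le _ _).trans (add_le_add ?_ ?_)
        · rw [abs_mul, abs_mul, abs_mul, abs_two, abs_of_nonneg (ρ0 y)]
        · rw [abs_mul, abs_pow]
          have := hp1 y hy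
          gcongr
          · nlinarith [abs_nonneg (p y)]
          · exact bρ' y
      rw [abs_mul (p y), abs_mul δ, abs_of_pos hδ, abs_of_nonneg (norm_nonneg (F y)),
        abs_of_nonneg (norm_nonneg (F1 y))]
      have h3 : δ * (|p y| * ‖F y‖ ^ 2) ≤ 1 * (|p y| * ‖F y‖ ^ 2) := by gcongr
      have h4 : (δ * |p' y|) * (2 * |p y| * ‖F y‖ ^ 2) ≤ C * (2 * |p y| * ‖F y‖ ^ 2) := by
        gcongr; exact hp'C y hy
      nlinarith
    rw [integral_linear_combination _ _ (by fun_prop) (by fun_prop)] at this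
    nlinarith
  obtain ⟨e0, e1⟩ := abs_endpoint_le_integral dρ cρ'
  obtain ⟨s0, s1⟩ := abs_endpoint_le_integral dσ cσ'
  have bdry : ∀ y ∈ Icc (0 : ℝ) 1, |ρ y| ≤ ∫ y in (0 : ℝ)..1, (|ρ y| + |ρ' y|) →
      |σ y| ≤ ∫ y in (0 : ℝ)..1, (|σ y| + |σ' y|) →
      δ * |p y * q y * ρ y| ≤ √(6 * C + 9) * √(A * n ^ 3) := by
    intro y hy h1 h2
    have h1' : δ * ρ y ≤ 3 * n ^ 2 := by
      rw [abs_of_nonneg (ρ0 y)] at h1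
      exact (mul_le_mul_of_nonneg_left h1 hδ.le).trans tr1
    have h2' : δ * (p y ^ 2 * ρ y) ≤ (2 * C + 3) * (A * n) := by
      rw [abs_of_nonneg (mul_nonneg (sq_nonneg _) (ρ0 y))] at h2
      exact (mul_le_mul_of_nonneg_left h2 hδ.le).trans tr2
    rw [← Real.sqrt_mul (by positivity)]
    refine Real.le_sqrt_of_sq_le ?_
    have h3 : q y ^ 2 ≤ 1 := by
      rw [← sq_abs]; exact pow_le_one₀ (abs_nonneg _) (hq1 y hy)
    calc (δ * |p y * q y * ρ y|) ^ 2
        = (δ * (p y ^ 2 * ρ y)) * (δ * ρ y) * q y ^ 2 := by rw [mul_pow, sq_abs]; ring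
      _ ≤ (δ * (p y ^ 2 * ρ y)) * (δ * ρ y) * 1 := by
          have := ρ0 y
          gcongr
      _ ≤ ((2 * C + 3) * (A * n)) * (3 * n ^ 2) * 1 := by
          have := ρ0 y
          gcongr
      _ ≤ _ := le_of_eq (by ring)
  have B0 := bdry 0 (by simp) e0 s0
  have B1 := bdry 1 (by simp) e1 s1
  -- integration by parts
  have ftc := integral_eq_sub_of_hasDerivWithinAt_Icc zero_le_one
    (f := fun y => p y * q y * ρ y)
    (f' := fun y => (p' y * q y + p y * q' y) * ρ y + p y * q y * ρ' y)
    (fun y hy => ((hp y hy).mul (hq y hy)).mul (dρ y hy)) (by fun_prop)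
  have main : ∫ y in (0 : ℝ)..1, (q y * ‖F y‖) ^ 2 ≤
      ∫ y in (0 : ℝ)..1, (δ * ((p' y * q y + p y * q' y) * ρ y + p y * q y * ρ' y) +
        (2 * C * (|p y * ‖F y‖| * |‖F y‖|) + 2 * (|p y * ‖F y‖| * |δ * ‖F1 y‖|))) := by
    refine integral_le_integral_of_continuousOn (by fun_prop) (by fun_prop)
      fun y hy => ?_
    have e : (q y * ‖F y‖) ^ 2 = δ * ((p' y * q y + p y * q' y) * ρ y + p y * q y * ρ' y) +
        (κ y * p y * q y * ρ y - p y * (δ * q' y) * ρ y - δ * (p y * q y * ρ' y)) := by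
      have := hpq y hy
      simp only [hρ]
      linear_combination (-(q y * ‖F y‖ ^ 2)) * this
    rw [e]
    refine add_le_add le_rfl ?_
    rw [abs_mul (p y), abs_mul δ, abs_of_pos hδ, abs_of_nonneg (norm_nonneg (F y)),
      abs_of_nonneg (norm_nonneg (F1 y))]
    have t1 : κ y * p y * q y * ρ y ≤ C * |p y| * 1 * ‖F y‖ ^ 2 := by
      refine (le_abs_self _).trans ?_
      rw [abs_mul, abs_mul, abs_mul, abs_of_nonneg (ρ0 y)]
      have := hκ y hy
      have := hq1 y hy
      gcongr
    have t2 : -(p y * (δ * q' y) * ρ y) ≤ |p y| * C * ‖F y‖ ^ 2 := by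
      refine (neg_le_abs _).trans ?_
      rw [abs_mul, abs_mul, abs_mul, abs_of_nonneg (ρ0 y), abs_of_pos hδ]
      have := hq'C y hy
      gcongr
    have t3 : -(δ * (p y * q y * ρ' y)) ≤ δ * (|p y| * 1 * (2 * (‖F y‖ * ‖F1 y‖))) := by
      refine (neg_le_abs _).trans ?_
      rw [abs_mul, abs_mul, abs_mul, abs_of_pos hδ]
      have := hq1 y hy
      have := bρ' y
      gcongr
    linarith
  rw [intervalIntegral.integral_add (intervalIntegrable_of_continuousOn (by fun_prop))
      (intervalIntegrable_of_continuousOn (by fun_prop)),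
      integral_linear_combination _ _ (by fun_prop) (by fun_prop),
      intervalIntegral.integral_const_mul, ftc] at main
  have hAn3 : A * n ≤ √(A * n ^ 3) := by
    refine Real.le_sqrt_of_sq_le ?_
    have : A * (A * n ^ 2) ≤ n * (A * n ^ 2) := by gcongr
    nlinarith
  rw [← abs_of_pos hδ, ← abs_mul] at B1
  have b1 := abs_le.1 B1
  rw [← abs_of_pos hδ, ← abs_mul] at B0
  have b0 := abs_le.1 B0
  have hC2 := mul_le_mul_of_nonneg_left cs1 (by positivity : 0 ≤ 2 * C)
  have hC3 := mul_le_mul_of_nonneg_left hAn3 (by positivity : 0 ≤ 2 * C)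
  linarith [b1.1, b1.2, b0.1, b0.2]

/-! ### The multipliers -/

/-- The weight `w = (∑_{j ≤ N+1} (δ^j b^{(j)})²)^{1/2}`, where `β j` stands for `b^{(j)}`
(for `j = 0`, for `b` minus a constant). -/
noncomputable def weight (β : ℕ → ℝ → ℝ) (N : ℕ) (δ y : ℝ) : ℝ :=
  √(∑ j ∈ Finset.range (N + 2), (δ ^ j * β j y) ^ 2)

/-- The normalised multiplier `χ_j = δ^j b^{(j)} / w`. -/
noncomputable def multiplier (β : ℕ → ℝ → ℝ) (N : ℕ) (δ : ℝ) (j : ℕ) (y : ℝ) : ℝ :=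
  δ ^ j * β j y / weight β N δ y

/-- The logarithmic derivative `w' / w` of the weight. -/
noncomputable def weightLogDeriv (β : ℕ → ℝ → ℝ) (N : ℕ) (δ y : ℝ) : ℝ :=
  (∑ j ∈ Finset.range (N + 2), (δ ^ j * β j y) * (δ ^ j * β (j + 1) y)) / weight β N δ y ^ 2

/-- The derivative of `χ_j`. -/
noncomputable def multiplierDeriv (β : ℕ → ℝ → ℝ) (N : ℕ) (δ : ℝ) (j : ℕ) (y : ℝ) : ℝ :=
  δ ^ j * β (j + 1) y / weight β N δ y - weightLogDeriv β N δ y * multiplier β N δ j y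

section

variable {β : ℕ → ℝ → ℝ} {N : ℕ} {c B δ y : ℝ}

theorem sq_weight : weight β N δ y ^ 2 = ∑ j ∈ Finset.range (N + 2), (δ ^ j * β j y) ^ 2 :=
  Real.sq_sqrt (Finset.sum_nonneg fun _ _ => sq_nonneg _)

/-- The nondegeneracy of the derivatives of order `1, …, N + 1` bounds the weight below, whatever the
value of `β 0`. -/
theorem mul_pow_le_weight (hδ : 0 < δ) (hδ1 : δ ≤ 1)
    (hlow : c ^ 2 ≤ ∑ j ∈ Finset.range (N + 1), β (j + 1) y ^ 2) :
    c * δ ^ (N + 1) ≤ weight β N δ y := by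
  refine Real.le_sqrt_of_sq_le ?_
  rw [Finset.sum_range_succ', mul_pow]
  calc c ^ 2 * (δ ^ (N + 1)) ^ 2
      ≤ (∑ j ∈ Finset.range (N + 1), β (j + 1) y ^ 2) * (δ ^ (N + 1)) ^ 2 := by gcongr
    _ ≤ ∑ j ∈ Finset.range (N + 1), (δ ^ (j + 1) * β (j + 1) y) ^ 2 := by
        rw [Finset.sum_mul]
        refine Finset.sum_le_sum fun j hj => ?_
        have : δ ^ (N + 1) ≤ δ ^ (j + 1) :=
          pow_le_pow_of_le_one hδ.le hδ1 (by have := Finset.mem_range.1 hj; omega)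
        rw [mul_pow, mul_comm]
        gcongr
    _ ≤ _ := le_add_of_nonneg_right (sq_nonneg _)

theorem abs_mul_le_weight {j : ℕ} (hj : j < N + 2) : |δ ^ j * β j y| ≤ weight β N δ y := by
  refine Real.abs_le_sqrt ?_
  exact Finset.single_le_sum (f := fun j => (δ ^ j * β j y) ^ 2) (fun _ _ => sq_nonneg _)
    (Finset.mem_range.2 hj)

/-- The scaled derivative `δ u_j' = u_{j+1}` of each entry of the weight is bounded by the weight. The
last entry leaves the sum, and is absorbed by the lower bound on `w`. -/
theorem abs_mul_succ_le_weight (hc : 0 < c) (hB : 0 ≤ B) (hδ : 0 < δ) (hδ1 : δ ≤ 1)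
    (hlow : c ^ 2 ≤ ∑ j ∈ Finset.range (N + 1), β (j + 1) y ^ 2) (hup : |β (N + 2) y| ≤ B)
    {j : ℕ} (hj : j < N + 2) :
    |δ ^ (j + 1) * β (j + 1) y| ≤ (1 + B / c) * weight β N δ y := by
  have hw : 0 ≤ weight β N δ y := Real.sqrt_nonneg _
  have hBc : 0 ≤ B / c := by positivity
  rcases Nat.lt_or_ge (j + 1) (N + 2) with h | h
  · refine (abs_mul_le_weight h).trans ?_
    nlinarith
  · obtain rfl : j = N + 1 := by omega
    rw [abs_mul, abs_of_pos (by positivity)]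
    have h1 := mul_pow_le_weight hδ hδ1 hlow
    calc δ ^ (N + 1 + 1) * |β (N + 1 + 1) y| ≤ δ ^ (N + 1) * B := by
          gcongr ?_ * ?_
          exact pow_le_pow_of_le_one hδ.le hδ1 (by omega)
      _ = B / c * (c * δ ^ (N + 1)) := by field_simp
      _ ≤ B / c * weight β N δ y := by gcongr
      _ ≤ _ := by nlinarith

theorem abs_multiplier_le_one {j : ℕ} (hj : j < N + 2) : |multiplier β N δ j y| ≤ 1 := by
  have hw : 0 ≤ weight β N δ y := Real.sqrt_nonneg _
  rw [multiplier, abs_div, abs_of_nonneg hw]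
  exact div_le_one_of_le₀ (abs_mul_le_weight hj) hw

theorem sum_sq_multiplier (hw : 0 < weight β N δ y) :
    ∑ j ∈ Finset.range (N + 2), multiplier β N δ j y ^ 2 = 1 := by
  simp only [multiplier, div_pow]
  rw [← Finset.sum_div, ← sq_weight, div_self (by positivity)]

theorem abs_weightLogDeriv_le (hc : 0 < c) (hB : 0 ≤ B) (hδ : 0 < δ) (hδ1 : δ ≤ 1)
    (hlow : c ^ 2 ≤ ∑ j ∈ Finset.range (N + 1), β (j + 1) y ^ 2) (hup : |β (N + 2) y| ≤ B) :
    |δ * weightLogDeriv β N δ y| ≤ (N + 2) * (1 + B / c) := by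
  have hw : 0 < weight β N δ y :=
    lt_of_lt_of_le (by positivity) (mul_pow_le_weight hδ hδ1 hlow)
  rw [weightLogDeriv, ← mul_div_assoc, Finset.mul_sum, abs_div, abs_of_pos (pow_pos hw 2),
    div_le_iff₀ (by positivity)]
  calc |∑ j ∈ Finset.range (N + 2), δ * (δ ^ j * β j y * (δ ^ j * β (j + 1) y))|
      ≤ ∑ j ∈ Finset.range (N + 2), |δ * (δ ^ j * β j y * (δ ^ j * β (j + 1) y))| :=
        Finset.abs_sum_le_sum_abs _ _
    _ ≤ ∑ j ∈ Finset.range (N + 2), (1 + B / c) * weight β N δ y ^ 2 := by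
        refine Finset.sum_le_sum fun j hj => ?_
        have hj := Finset.mem_range.1 hj
        have h1 := abs_mul_le_weight (β := β) (δ := δ) (y := y) hj
        have h2 := abs_mul_succ_le_weight hc hB hδ hδ1 hlow hup hj
        calc |δ * (δ ^ j * β j y * (δ ^ j * β (j + 1) y))|
            = |δ ^ j * β j y| * |δ ^ (j + 1) * β (j + 1) y| := by rw [← abs_mul]; ring_nf
          _ ≤ weight β N δ y * ((1 + B / c) * weight β N δ y) := by gcongr
          _ = _ := by ring
    _ = _ := by simp; ring

theorem mul_multiplierDeriv {j : ℕ} : δ * multiplierDeriv β N δ j y =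
    δ ^ (j + 1) * β (j + 1) y / weight β N δ y -
      δ * weightLogDeriv β N δ y * multiplier β N δ j y := by
  rw [multiplierDeriv]; ring

theorem abs_multiplierDeriv_le (hc : 0 < c) (hB : 0 ≤ B) (hδ : 0 < δ) (hδ1 : δ ≤ 1)
    (hlow : c ^ 2 ≤ ∑ j ∈ Finset.range (N + 1), β (j + 1) y ^ 2) (hup : |β (N + 2) y| ≤ B)
    {j : ℕ} (hj : j < N + 2) :
    δ * |multiplierDeriv β N δ j y| ≤ (N + 3) * (1 + B / c) := by
  have hw : 0 < weight β N δ y :=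
    lt_of_lt_of_le (by positivity) (mul_pow_le_weight hδ hδ1 hlow)
  rw [← abs_of_pos hδ, ← abs_mul, abs_of_pos hδ, mul_multiplierDeriv]
  refine (abs_sub _ _).trans ?_
  have h1 : |δ ^ (j + 1) * β (j + 1) y / weight β N δ y| ≤ 1 + B / c := by
    rw [abs_div, abs_of_pos hw, div_le_iff₀ hw]
    exact abs_mul_succ_le_weight hc hB hδ hδ1 hlow hup hj
  have h2 : |δ * weightLogDeriv β N δ y * multiplier β N δ j y| ≤ (N + 2) * (1 + B / c) * 1 := by
    rw [abs_mul]
    have := abs_weightLogDeriv_le hc hB hδ hδ1 hlow hup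
    have := abs_multiplier_le_one (β := β) (δ := δ) (y := y) hj
    gcongr
  linarith

theorem hasDerivWithinAt_weight
    (hβ : ∀ j, ∀ y ∈ Icc (0 : ℝ) 1, HasDerivWithinAt (β j) (β (j + 1) y) (Icc 0 1) y)
    (hy : y ∈ Icc (0 : ℝ) 1) (hw : 0 < weight β N δ y) :
    HasDerivWithinAt (weight β N δ) (weightLogDeriv β N δ y * weight β N δ y) (Icc 0 1) y := by
  have h1 : HasDerivWithinAt (fun y => ∑ j ∈ Finset.range (N + 2), (δ ^ j * β j y) ^ 2)
      (∑ j ∈ Finset.range (N + 2), 2 * (δ ^ j * β j y) * (δ ^ j * β (j + 1) y)) (Icc 0 1) y := by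
    refine HasDerivWithinAt.fun_sum fun j _ => ?_
    have := ((hβ j y hy).const_mul (δ ^ j)).fun_pow 2
    simpa using this
  have h2 := h1.sqrt (by rw [← sq_weight]; positivity)
  refine h2.congr_deriv ?_
  change _ / (2 * weight β N δ y) = _
  rw [weightLogDeriv, sq]
  simp only [mul_assoc]
  rw [← Finset.mul_sum]
  field_simp

theorem hasDerivWithinAt_multiplier
    (hβ : ∀ j, ∀ y ∈ Icc (0 : ℝ) 1, HasDerivWithinAt (β j) (β (j + 1) y) (Icc 0 1) y)
    (hy : y ∈ Icc (0 : ℝ) 1) (hw : 0 < weight β N δ y) (j : ℕ) :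
    HasDerivWithinAt (multiplier β N δ j) (multiplierDeriv β N δ j y) (Icc 0 1) y := by
  have := ((hβ j y hy).const_mul (δ ^ j)).fun_div (hasDerivWithinAt_weight hβ hy hw) hw.ne'
  refine this.congr_deriv ?_
  rw [multiplierDeriv, multiplier]
  field_simp

theorem continuousOn_multiplierDeriv
    (hβ : ∀ j, ∀ y ∈ Icc (0 : ℝ) 1, HasDerivWithinAt (β j) (β (j + 1) y) (Icc 0 1) y)
    (hw : ∀ y ∈ Icc (0 : ℝ) 1, 0 < weight β N δ y) (j : ℕ) :
    ContinuousOn (multiplierDeriv β N δ j) (Icc 0 1) := by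
  have cβ : ∀ j, ContinuousOn (β j) (Icc 0 1) :=
    fun j y hy => (hβ j y hy).continuousWithinAt
  have cw : ContinuousOn (weight β N δ) (Icc 0 1) :=
    fun y hy => (hasDerivWithinAt_weight hβ hy (hw y hy)).continuousWithinAt
  have cm : ContinuousOn (multiplier β N δ j) (Icc 0 1) :=
    fun y hy => (hasDerivWithinAt_multiplier hβ hy (hw y hy) j).continuousWithinAt
  have cl : ContinuousOn (weightLogDeriv β N δ) (Icc 0 1) := by
    refine ContinuousOn.div ?_ (cw.pow 2) fun y hy => (pow_pos (hw y hy) 2).ne'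
    exact continuousOn_finsetSum _ fun j _ =>
      (continuousOn_const.mul (cβ j)).mul (continuousOn_const.mul (cβ _))
  exact ((continuousOn_const.mul (cβ _)).div cw fun y hy => (hw y hy).ne').sub (cl.mul cm)

end

/-! ### The resolvent estimate -/

/-- The boundary terms `F' \bar F` of an integration by parts vanish, either separately at the two
end points (Dirichlet, Neumann) or by cancellation (periodic). In the second case the multipliers
must be periodic as well, which is recorded by the values of `β j`. -/
def BoundaryVanishes (β : ℕ → ℝ → ℝ) (F F1 : ℝ → ℂ) : Prop :=
  ((F 0 = 0 ∨ F1 0 = 0) ∧ (F 1 = 0 ∨ F1 1 = 0)) ∨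
    (F 0 = F 1 ∧ F1 0 = F1 1 ∧ ∀ j, β j 0 = β j 1)

/-- Integration by parts for `Re ∫ F'' \bar F`. -/
theorem integral_inner_deriv_deriv_eq {β : ℕ → ℝ → ℝ} {F F1 F2 : ℝ → ℂ}
    (hF : ∀ y ∈ Icc (0 : ℝ) 1, HasDerivWithinAt F (F1 y) (Icc 0 1) y)
    (hF1 : ∀ y ∈ Icc (0 : ℝ) 1, HasDerivWithinAt F1 (F2 y) (Icc 0 1) y)
    (cF2 : ContinuousOn F2 (Icc 0 1)) (hbc : BoundaryVanishes β F F1) :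
    ∫ y in (0 : ℝ)..1, inner ℝ (F y) (F2 y) = -∫ y in (0 : ℝ)..1, ‖F1 y‖ ^ 2 := by
  have cF : ContinuousOn F (Icc 0 1) := fun y hy => (hF y hy).continuousWithinAt
  have cF1 : ContinuousOn F1 (Icc 0 1) := fun y hy => (hF1 y hy).continuousWithinAt
  have ci : ContinuousOn (fun y => inner ℝ (F y) (F2 y)) (Icc 0 1) := cF.inner cF2
  have h := integral_eq_sub_of_hasDerivWithinAt_Icc zero_le_one
    (fun y hy => (hF y hy).inner ℝ (hF1 y hy)) (ci.add (cF1.inner cF1))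
  have hb : inner ℝ (F 1) (F1 1) - inner ℝ (F 0) (F1 0) = 0 := by
    rcases hbc with ⟨h0, h1⟩ | ⟨h0, h1, -⟩
    · rcases h0 with h0 | h0 <;> rcases h1 with h1 | h1 <;> simp [h0, h1]
    · simp [h0, h1]
  rw [hb, intervalIntegral.integral_add (intervalIntegrable_of_continuousOn ci)
    (intervalIntegrable_of_continuousOn (cF1.inner cF1))] at h
  simp only [real_inner_self_eq_norm_sq] at h
  linarith

/-- Integration by parts for `Im ∫ χ F'' \bar F`. -/
theorem integral_inner_I_mul_eq {χ χ' : ℝ → ℝ} {F F1 F2 : ℝ → ℂ}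
    (hχ : ∀ y ∈ Icc (0 : ℝ) 1, HasDerivWithinAt χ (χ' y) (Icc 0 1) y)
    (cχ' : ContinuousOn χ' (Icc 0 1))
    (hF : ∀ y ∈ Icc (0 : ℝ) 1, HasDerivWithinAt F (F1 y) (Icc 0 1) y)
    (hF1 : ∀ y ∈ Icc (0 : ℝ) 1, HasDerivWithinAt F1 (F2 y) (Icc 0 1) y)
    (cF2 : ContinuousOn F2 (Icc 0 1))
    (hbc : ((F 0 = 0 ∨ F1 0 = 0) ∧ (F 1 = 0 ∨ F1 1 = 0)) ∨
      (F 0 = F 1 ∧ F1 0 = F1 1 ∧ χ 0 = χ 1)) :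
    ∫ y in (0 : ℝ)..1, χ y * inner ℝ (Complex.I * F y) (F2 y) =
      -∫ y in (0 : ℝ)..1, χ' y * inner ℝ (Complex.I * F y) (F1 y) := by
  have cχ : ContinuousOn χ (Icc 0 1) := fun y hy => (hχ y hy).continuousWithinAt
  have cF : ContinuousOn F (Icc 0 1) := fun y hy => (hF y hy).continuousWithinAt
  have cF1 : ContinuousOn F1 (Icc 0 1) := fun y hy => (hF1 y hy).continuousWithinAt
  have cIF : ContinuousOn (fun y => Complex.I * F y) (Icc 0 1) := continuousOn_const.mul cF
  have c1 : ContinuousOn (fun y => inner ℝ (Complex.I * F y) (F1 y)) (Icc 0 1) := cIF.inner cF1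
  have c2 : ContinuousOn (fun y => inner ℝ (Complex.I * F y) (F2 y)) (Icc 0 1) := cIF.inner cF2
  have h := integral_eq_sub_of_hasDerivWithinAt_Icc zero_le_one
    (f := fun y => χ y * inner ℝ (Complex.I * F y) (F1 y))
    (f' := fun y => χ' y * inner ℝ (Complex.I * F y) (F1 y) +
      χ y * inner ℝ (Complex.I * F y) (F2 y)) (fun y hy => by
        refine ((hχ y hy).mul (((hF y hy).const_mul Complex.I).inner ℝ (hF1 y hy))).congr_deriv ?_
        -- `Re (i F' \bar F') = 0`
        have : inner ℝ (Complex.I * F1 y) (F1 y) = 0 := by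
          simp [Complex.inner]; ring
        rw [this, add_zero]) ((cχ'.mul c1).add (cχ.mul c2))
  have hb : χ 1 * inner ℝ (Complex.I * F 1) (F1 1) -
      χ 0 * inner ℝ (Complex.I * F 0) (F1 0) = 0 := by
    rcases hbc with ⟨h0, h1⟩ | ⟨h0, h1, h2⟩
    · rcases h0 with h0 | h0 <;> rcases h1 with h1 | h1 <;> simp [h0, h1]
    · simp [h0, h1, h2]
  rw [hb, intervalIntegral.integral_add
    (f := fun y => χ' y * inner ℝ (Complex.I * F y) (F1 y))
    (g := fun y => χ y * inner ℝ (Complex.I * F y) (F2 y))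
    (intervalIntegrable_of_continuousOn (cχ'.mul c1))
    (intervalIntegrable_of_continuousOn (cχ.mul c2))] at h
  linarith

set_option maxHeartbeats 1000000 in
/-- **Resolvent estimate.** If `b - λ = β 0` has a derivative of order between `1` and `N + 1`
bounded below at every point, then `i α (b - λ) - ν ∂_yy`, with `ν = δ^(N+3)` and `|α| ≥ 1`, is
bounded below by a multiple of `δ^(N+1) = ν^((N+1)/(N+3))`, uniformly in `λ` and `α`. -/
theorem exists_resolvent_estimate (N : ℕ) {c B : ℝ} (hc : 0 < c) (hB : 0 ≤ B) :
    ∃ ε > 0, ∀ (β : ℕ → ℝ → ℝ) (δ α : ℝ) (F F1 F2 G : ℝ → ℂ),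
      (∀ j, ∀ y ∈ Icc (0 : ℝ) 1, HasDerivWithinAt (β j) (β (j + 1) y) (Icc 0 1) y) →
      (∀ y ∈ Icc (0 : ℝ) 1, c ^ 2 ≤ ∑ j ∈ Finset.range (N + 1), β (j + 1) y ^ 2) →
      (∀ y ∈ Icc (0 : ℝ) 1, |β (N + 2) y| ≤ B) → 0 < δ → δ ≤ 1 → 1 ≤ |α| →
      (∀ y ∈ Icc (0 : ℝ) 1, HasDerivWithinAt F (F1 y) (Icc 0 1) y) →
      (∀ y ∈ Icc (0 : ℝ) 1, HasDerivWithinAt F1 (F2 y) (Icc 0 1) y) →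
      ContinuousOn F2 (Icc 0 1) →
      BoundaryVanishes β F F1 →
      (∀ y ∈ Icc (0 : ℝ) 1,
        Complex.I * (α * β 0 y : ℝ) * F y - (δ ^ (N + 3) : ℝ) * F2 y = G y) →
      (ε * δ ^ (N + 1)) ^ 2 * ∫ y in (0 : ℝ)..1, ‖F y‖ ^ 2 ≤ ∫ y in (0 : ℝ)..1, ‖G y‖ ^ 2 := by
  have hBc : 0 ≤ B / c := by positivity
  set C : ℝ := (N + 3) * (1 + B / c) with hC
  have hC0 : 0 ≤ C := by positivity
  set K : ℝ := 2 * C + 2 + 2 * √(6 * C + 9) with hK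
  obtain ⟨η, hη, Hη⟩ := exists_le_of_sq_succ_le_sqrt K (N + 1)
  -- `ε = τ²`, with `τ` so small that the imaginary part forces the first multiplier below `η`
  set τ : ℝ := min 1 (c * η ^ 2 / (2 * (1 + C))) with hτ
  have hτ0 : 0 < τ := lt_min one_pos (by positivity)
  have hτ1 : τ ≤ 1 := min_le_left _ _
  have hτ2 : τ * (1 + C) < c * η ^ 2 := by
    have : τ ≤ c * η ^ 2 / (2 * (1 + C)) := min_le_right _ _
    rw [le_div_iff₀ (by positivity)] at this
    have : 0 < τ * (1 + C) := by positivity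
    linarith
  refine ⟨τ ^ 2, by positivity, ?_⟩
  intro β δ α F F1 F2 G hβ hlow hup hδ hδ1 hα hF hF1 cF2 hbc heq
  by_contra! hlt
  have cβ0 : ContinuousOn (β 0) (Icc 0 1) := fun y hy => (hβ 0 y hy).continuousWithinAt
  have cF : ContinuousOn F (Icc 0 1) := fun y hy => (hF y hy).continuousWithinAt
  have cF1 : ContinuousOn F1 (Icc 0 1) := fun y hy => (hF1 y hy).continuousWithinAt
  have cG : ContinuousOn G (Icc 0 1) := by
    refine ContinuousOn.congr ?_ fun y hy => (heq y hy).symm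
    fun_prop
  set r := δ ^ (N + 1) with hr
  have hr0 : 0 < r := by positivity
  set n := √(∫ y in (0 : ℝ)..1, ‖F y‖ ^ 2) with hn
  set D := √(∫ y in (0 : ℝ)..1, ‖F1 y‖ ^ 2) with hD
  set γ := √(∫ y in (0 : ℝ)..1, ‖G y‖ ^ 2) with hγ
  have nn : ∀ f : ℝ → ℝ, 0 ≤ ∫ y in (0 : ℝ)..1, f y ^ 2 := fun f =>
    intervalIntegral.integral_nonneg zero_le_one fun y _ => sq_nonneg _
  have n2 : n ^ 2 = ∫ y in (0 : ℝ)..1, ‖F y‖ ^ 2 := Real.sq_sqrt (nn _)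
  have D2 : D ^ 2 = ∫ y in (0 : ℝ)..1, ‖F1 y‖ ^ 2 := Real.sq_sqrt (nn _)
  have γ2 : γ ^ 2 = ∫ y in (0 : ℝ)..1, ‖G y‖ ^ 2 := Real.sq_sqrt (nn _)
  have hn0' : 0 ≤ n := Real.sqrt_nonneg _
  have hD0 : 0 ≤ D := Real.sqrt_nonneg _
  have hγ0 : 0 ≤ γ := Real.sqrt_nonneg _
  rw [← n2, ← γ2, ← mul_pow] at hlt
  have hγlt : γ < τ ^ 2 * r * n := lt_of_pow_lt_pow_left₀ 2 (by positivity) hlt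
  have hn0 : 0 < n := by
    rcases hn0'.eq_or_lt with h | h
    · rw [← h, mul_zero] at hγlt; linarith
    · exact h
  have csGF : ∫ y in (0 : ℝ)..1, |‖G y‖| * |‖F y‖| ≤ γ * n :=
    integral_abs_mul_abs_le_sqrt (by fun_prop) (by fun_prop)
  have csFF : ∫ y in (0 : ℝ)..1, |‖F1 y‖| * |‖F y‖| ≤ D * n :=
    integral_abs_mul_abs_le_sqrt (by fun_prop) (by fun_prop)
  simp only [abs_norm] at csGF csFF
  -- real part of the pairing with `F`
  have hre : δ ^ (N + 3) * D ^ 2 ≤ γ * n := by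
    rw [D2, ← neg_neg (∫ y in (0 : ℝ)..1, ‖F1 y‖ ^ 2), ← integral_inner_deriv_deriv_eq hF hF1 cF2 hbc,
      mul_neg, ← mul_neg, ← intervalIntegral.integral_neg, ← intervalIntegral.integral_const_mul]
    refine le_trans ?_ csGF
    refine integral_le_integral_of_continuousOn ?_ (by fun_prop) fun y hy => ?_
    · exact continuousOn_const.mul (cF.inner cF2).neg
    · have : δ ^ (N + 3) * -inner ℝ (F y) (F2 y) = inner ℝ (F y) (G y) := by
        rw [← heq y hy]
        simp only [Complex.inner, Complex.mul_re, Complex.sub_re, Complex.conj_re, Complex.conj_im,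
          Complex.sub_im, Complex.mul_im, Complex.I_re, Complex.I_im, Complex.ofReal_re,
          Complex.ofReal_im]
        ring
      rw [this, mul_comm]
      exact real_inner_le_norm _ _
  have hδD : δ * D ≤ τ * n := by
    refine le_of_sq_le_sq ?_ (by positivity)
    have : r * (δ * D) ^ 2 ≤ r * (τ * n) ^ 2 := by
      calc r * (δ * D) ^ 2 = δ ^ (N + 3) * D ^ 2 := by rw [hr]; ring
        _ ≤ γ * n := hre
        _ ≤ (τ ^ 2 * r * n) * n := by gcongr
        _ = _ := by ring
    exact le_of_mul_le_mul_left this hr0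
  have hw : ∀ y ∈ Icc (0 : ℝ) 1, 0 < weight β N δ y := fun y hy =>
    lt_of_lt_of_le (by positivity) (mul_pow_le_weight hδ hδ1 (hlow y hy))
  have dχ := fun j => fun y hy => hasDerivWithinAt_multiplier (N := N) (δ := δ) hβ hy (hw y hy) j
  have cχ' := fun j => continuousOn_multiplierDeriv (N := N) (δ := δ) hβ hw j
  have cχ : ∀ j, ContinuousOn (multiplier β N δ j) (Icc 0 1) :=
    fun j y hy => (dχ j y hy).continuousWithinAt
  have bχ' := fun {j : ℕ} (hj : j < N + 2) y hy =>
    abs_multiplierDeriv_le (y := y) hc hB hδ hδ1 (hlow y hy) (hup y hy) hj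
  have hw0 : ∀ y ∈ Icc (0 : ℝ) 1, β 0 y = multiplier β N δ 0 y * weight β N δ y := fun y hy => by
    rw [multiplier, pow_zero, one_mul, div_mul_cancel₀ _ (hw y hy).ne']
  -- imaginary part of the pairing with `χ₀ F`
  have cIF : ContinuousOn (fun y => Complex.I * F y) (Icc 0 1) := continuousOn_const.mul cF
  have cIF1 : ContinuousOn (fun y => inner ℝ (Complex.I * F y) (F1 y)) (Icc 0 1) := cIF.inner cF1
  have cIF2 : ContinuousOn (fun y => inner ℝ (Complex.I * F y) (F2 y)) (Icc 0 1) := cIF.inner cF2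
  have cIG : ContinuousOn (fun y => inner ℝ (Complex.I * F y) (G y)) (Icc 0 1) := cIF.inner cG
  have him : |∫ y in (0 : ℝ)..1, α * (multiplier β N δ 0 y * β 0 y * ‖F y‖ ^ 2)| ≤
      τ * (1 + C) * (r * n ^ 2) := by
    have e1 : ∫ y in (0 : ℝ)..1, α * (multiplier β N δ 0 y * β 0 y * ‖F y‖ ^ 2) =
        ∫ y in (0 : ℝ)..1, (1 * (multiplier β N δ 0 y * inner ℝ (Complex.I * F y) (G y)) +
          δ ^ (N + 3) * (multiplier β N δ 0 y * inner ℝ (Complex.I * F y) (F2 y))) := by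
      refine intervalIntegral.integral_congr fun y hy => ?_
      rw [uIcc_of_le zero_le_one] at hy
      rw [← heq y hy, ← Complex.normSq_eq_norm_sq, Complex.normSq_apply]
      simp only [Complex.inner, Complex.mul_re, Complex.sub_re, Complex.conj_re, Complex.conj_im,
          Complex.sub_im, Complex.mul_im, Complex.I_re, Complex.I_im, Complex.ofReal_re,
          Complex.ofReal_im]
      ring
    have e2 : ∫ y in (0 : ℝ)..1, multiplier β N δ 0 y * inner ℝ (Complex.I * F y) (F2 y) =
        -∫ y in (0 : ℝ)..1, multiplierDeriv β N δ 0 y * inner ℝ (Complex.I * F y) (F1 y) := by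
      refine integral_inner_I_mul_eq (dχ 0) (cχ' 0) hF hF1 cF2 (hbc.imp_right fun h => ?_)
      refine ⟨h.1, h.2.1, ?_⟩
      simp only [multiplier, weight, h.2.2]
    have cχ0 := cχ 0
    have cχ'0 := cχ' 0
    rw [e1, integral_linear_combination _ _ (by fun_prop) (by fun_prop), e2, one_mul, mul_neg,
      ← sub_eq_add_neg]
    refine (abs_sub _ _).trans ?_
    have t1 : |∫ y in (0 : ℝ)..1, multiplier β N δ 0 y * inner ℝ (Complex.I * F y) (G y)| ≤
        γ * n := by
      refine (intervalIntegral.abs_integral_le_integral_abs zero_le_one).trans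
        (le_trans ?_ csGF)
      refine integral_le_integral_of_continuousOn (by fun_prop) (by fun_prop) fun y hy => ?_
      have h1 := abs_real_inner_le_norm (Complex.I * F y) (G y)
      rw [norm_mul, Complex.norm_I, one_mul] at h1
      have h2 : |multiplier β N δ 0 y| ≤ 1 := abs_multiplier_le_one (by omega)
      calc |multiplier β N δ 0 y * inner ℝ (Complex.I * F y) (G y)|
          = |multiplier β N δ 0 y| * |inner ℝ (Complex.I * F y) (G y)| := abs_mul _ _
        _ ≤ 1 * (‖F y‖ * ‖G y‖) := by gcongr
        _ = _ := by ring
    have t2 : |δ ^ (N + 3) * ∫ y in (0 : ℝ)..1,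
        multiplierDeriv β N δ 0 y * inner ℝ (Complex.I * F y) (F1 y)| ≤ r * C * (δ * D) * n := by
      rw [← intervalIntegral.integral_const_mul]
      refine (intervalIntegral.abs_integral_le_integral_abs zero_le_one).trans ?_
      have : r * C * (δ * D) * n = r * C * δ * (D * n) := by ring
      rw [this]
      refine le_trans ?_ (mul_le_mul_of_nonneg_left csFF (by positivity))
      rw [← intervalIntegral.integral_const_mul]
      refine integral_le_integral_of_continuousOn (by fun_prop) (by fun_prop) fun y hy => ?_
      have h1 := abs_real_inner_le_norm (Complex.I * F y) (F1 y)
      rw [norm_mul, Complex.norm_I, one_mul] at h1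
      have h2 := bχ' (show 0 < N + 2 by omega) y hy
      calc |δ ^ (N + 3) * (multiplierDeriv β N δ 0 y * inner ℝ (Complex.I * F y) (F1 y))|
          = r * δ * (δ * |multiplierDeriv β N δ 0 y|) * |inner ℝ (Complex.I * F y) (F1 y)| := by
            rw [abs_mul, abs_mul, abs_of_pos (by positivity), hr]; ring
        _ ≤ r * δ * C * (‖F y‖ * ‖F1 y‖) := by gcongr
        _ = _ := by ring
    calc _ ≤ γ * n + r * C * (δ * D) * n := add_le_add t1 t2
      _ ≤ (τ ^ 2 * r * n) * n + r * C * (τ * n) * n := by gcongr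
      _ ≤ (τ * r * n) * n + r * C * (τ * n) * n := by
          gcongr
          nlinarith
      _ = _ := by ring
  set A : ℕ → ℝ := fun j => √(∫ y in (0 : ℝ)..1, (multiplier β N δ j y * ‖F y‖) ^ 2) with hA
  have A2 : ∀ j, A j ^ 2 = ∫ y in (0 : ℝ)..1, (multiplier β N δ j y * ‖F y‖) ^ 2 :=
    fun j => Real.sq_sqrt (nn _)
  have hA0 : A 0 < η * n := by
    refine lt_of_pow_lt_pow_left₀ 2 (by positivity) ?_
    have h1 : c * r * A 0 ^ 2 ≤ τ * (1 + C) * (r * n ^ 2) := by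
      refine le_trans ?_ him
      rw [intervalIntegral.integral_const_mul, abs_mul, A2]
      have cχ0 := cχ 0
      have h2 : c * r * ∫ y in (0 : ℝ)..1, (multiplier β N δ 0 y * ‖F y‖) ^ 2 ≤
          ∫ y in (0 : ℝ)..1, multiplier β N δ 0 y * β 0 y * ‖F y‖ ^ 2 := by
        rw [← intervalIntegral.integral_const_mul]
        refine integral_le_integral_of_continuousOn (by fun_prop) (by fun_prop) fun y hy => ?_
        have h3 : c * r ≤ weight β N δ y := mul_pow_le_weight hδ hδ1 (hlow y hy)
        rw [hw0 y hy]
        exact (mul_le_mul_of_nonneg_right h3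
          (sq_nonneg (multiplier β N δ 0 y * ‖F y‖))).trans_eq (by ring)
      refine h2.trans ((le_abs_self _).trans ?_)
      exact le_mul_of_one_le_left (abs_nonneg _) hα
    have h4 : c * r * A 0 ^ 2 < c * r * (η * n) ^ 2 := by
      calc _ ≤ _ := h1
        _ < c * η ^ 2 * (r * n ^ 2) := by gcongr
        _ = _ := by ring
    exact lt_of_mul_lt_mul_left h4 (by positivity)
  have hsum : ∑ j ∈ Finset.range (N + 2), A j ^ 2 = n ^ 2 := by
    simp only [A2]
    rw [← intervalIntegral.integral_finsetSum
      (f := fun j y => (multiplier β N δ j y * ‖F y‖) ^ 2)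
      fun j _ => intervalIntegrable_of_continuousOn (((cχ j).mul cF.norm).pow 2), n2]
    refine intervalIntegral.integral_congr fun y hy => ?_
    rw [uIcc_of_le zero_le_one] at hy
    simp only [mul_pow]
    rw [← Finset.sum_mul, sum_sq_multiplier (hw y hy), one_mul]
  have := Hη (fun j => A j / n) (fun j => div_nonneg (Real.sqrt_nonneg _) hn0.le)
    (fun j hj => ?_) (by simp only [div_pow]; rw [← Finset.sum_div, hsum, div_self (by positivity)])
  · rw [le_div_iff₀ hn0] at this
    linarith
  · have hs := commutator_step (C := C) hC0 hδ hδ1 (dχ j) (dχ (j + 1)) hF (cχ' j) (cχ' (j + 1)) cF1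
      (κ := fun y => δ * weightLogDeriv β N δ y) (fun y _ => mul_multiplierDeriv)
      (fun y hy => (abs_weightLogDeriv_le hc hB hδ hδ1 (hlow y hy) (hup y hy)).trans (by
        rw [hC]; gcongr; linarith))
      (fun y _ => abs_multiplier_le_one (by omega)) (fun y _ => abs_multiplier_le_one (by omega))
      (bχ' (by omega)) (bχ' (by omega)) (hδD.trans (by nlinarith))
    rw [← A2] at hs
    have e : √(A j * n ^ 3) = √(A j / n) * n ^ 2 := by
      rw [← Real.sqrt_sq (show 0 ≤ n ^ 2 by positivity), ← Real.sqrt_mul' _ (by positivity)]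
      congr 1
      field_simp
    change A (j + 1) ^ 2 ≤ K * √(A j * n ^ 3) at hs
    rw [e] at hs
    rw [div_pow, div_le_iff₀ (by positivity)]
    linarith

/-! ### Parametric integrals and Parseval's identity -/

theorem continuousOn_prod_swap {X Y E : Type*} [TopologicalSpace E] [TopologicalSpace X] [TopologicalSpace Y]
    {S : Set X} {T : Set Y} {h : X → Y → E}
    (hh : ContinuousOn (fun p : X × Y => h p.1 p.2) (S ×ˢ T)) :
    ContinuousOn (fun p : Y × X => h p.2 p.1) (T ×ˢ S) :=
  hh.comp continuous_swap.continuousOn fun _ hp => ⟨hp.2, hp.1⟩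

theorem continuousOn_slice_left {X Y E : Type*} [TopologicalSpace E] [TopologicalSpace X] [TopologicalSpace Y]
    {S : Set X} {T : Set Y} {h : X → Y → E}
    (hh : ContinuousOn (fun p : X × Y => h p.1 p.2) (S ×ˢ T)) {y : Y} (hy : y ∈ T) :
    ContinuousOn (fun x => h x y) S :=
  hh.comp (f := fun x => (x, y)) (by fun_prop) fun _ hx => ⟨hx, hy⟩

section Parametric

variable {E : Type*} [NormedAddCommGroup E] [NormedSpace ℝ E]

theorem continuousOn_intervalIntegral {X : Type*} [TopologicalSpace X] [FirstCountableTopology X]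
    {a b : ℝ} (hab : a ≤ b) {S : Set X} {h : ℝ → X → E}
    (hh : ContinuousOn (fun p : ℝ × X => h p.1 p.2) (Icc a b ×ˢ S)) :
    ContinuousOn (fun p => ∫ x in a..b, h x p) S := by
  rw [continuousOn_iff_continuous_domRestrict]
  have hc : Continuous (Function.uncurry fun (p : S) (x : ℝ) => h (projIcc a b hab x) p) := by
    refine hh.comp_continuous (f := fun q : S × ℝ => ((projIcc a b hab q.2 : ℝ), (q.1 : X)))
      (by fun_prop) fun q => ⟨(projIcc a b hab q.2).2, q.1.2⟩
  have := intervalIntegral.continuous_parametric_intervalIntegral_of_continuous' (μ := volume)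
    hc a b
  refine this.congr fun p => intervalIntegral.integral_congr fun x hx => ?_
  rw [uIcc_of_le hab] at hx
  simp only [projIcc_of_mem hab hx]

theorem intervalIntegral_swap_of_continuousOn {a b c d : ℝ} (hab : a ≤ b) (hcd : c ≤ d)
    {h : ℝ → ℝ → E} (hh : ContinuousOn (fun p : ℝ × ℝ => h p.1 p.2) (Icc a b ×ˢ Icc c d)) :
    ∫ x in a..b, ∫ y in c..d, h x y = ∫ y in c..d, ∫ x in a..b, h x y := by
  refine intervalIntegral_intervalIntegral_swap ?_
  rw [uIoc_of_le hab, uIoc_of_le hcd]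
  exact (hh.integrableOn_compact (isCompact_Icc.prod isCompact_Icc)).mono_set
    (prod_mono Ioc_subset_Icc_self Ioc_subset_Icc_self)

/-- Differentiation under the integral sign, up to the end points of the parameter interval. -/
theorem hasDerivWithinAt_intervalIntegral [CompleteSpace E] {a b c d : ℝ} (hab : a ≤ b)
    {h h' : ℝ → ℝ → E}
    (hh : ContinuousOn (fun p : ℝ × ℝ => h p.1 p.2) (Icc a b ×ˢ Icc c d))
    (hh' : ContinuousOn (fun p : ℝ × ℝ => h' p.1 p.2) (Icc a b ×ˢ Icc c d))
    (hd : ∀ x ∈ Icc a b, ∀ y ∈ Icc c d, HasDerivWithinAt (h x) (h' x y) (Icc c d) y)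
    {y : ℝ} (hy : y ∈ Icc c d) :
    HasDerivWithinAt (fun y => ∫ x in a..b, h x y) (∫ x in a..b, h' x y) (Icc c d) y := by
  have hcd : c ≤ d := hy.1.trans hy.2
  set J : ℝ → E := fun y => ∫ x in a..b, h' x y with hJ
  have cJ : ContinuousOn J (Icc c d) := continuousOn_intervalIntegral hab hh'
  have cJe : Continuous (fun y => J (projIcc c d hcd y)) :=
    cJ.comp_continuous (by fun_prop) fun y => (projIcc c d hcd y).2
  have hprim : ∀ z ∈ Icc c d, ∫ x in a..b, h x z =
      (∫ x in a..b, h x c) + ∫ t in c..z, J (projIcc c d hcd t) := by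
    intro z hz
    have hsub : Icc c z ⊆ Icc c d := Icc_subset_Icc_right hz.2
    have e1 : ∫ t in c..z, J (projIcc c d hcd t) = ∫ t in c..z, ∫ x in a..b, h' x t := by
      refine intervalIntegral.integral_congr fun t ht => ?_
      rw [uIcc_of_le hz.1] at ht
      simp only [projIcc_of_mem hcd (hsub ht), hJ]
    have e2 : ∫ x in a..b, ∫ t in c..z, h' x t = ∫ x in a..b, (h x z - h x c) := by
      refine intervalIntegral.integral_congr fun x hx => ?_
      rw [uIcc_of_le hab] at hx
      exact integral_eq_sub_of_hasDerivWithinAt_Icc hz.1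
        (fun t ht => (hd x hx t (hsub ht)).mono hsub)
        (hh'.comp (f := fun t => (x, t)) (by fun_prop) fun t ht => ⟨hx, hsub ht⟩)
    have ci : ∀ t ∈ Icc c d, IntervalIntegrable (fun x => h x t) volume a b := fun t ht =>
      ContinuousOn.intervalIntegrable
        (by rw [uIcc_of_le hab]; exact continuousOn_slice_left hh ht)
    rw [e1, ← intervalIntegral_swap_of_continuousOn hab hz.1 (hh'.mono (prod_mono le_rfl hsub)), e2,
      intervalIntegral.integral_sub (ci z hz) (ci c (left_mem_Icc.2 hcd))]
    abel
  have key : HasDerivWithinAt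
      (fun z => (∫ x in a..b, h x c) + ∫ t in c..z, J (projIcc c d hcd t)) (J y) (Icc c d) y := by
    have := ((cJe.integral_hasStrictDerivAt c y).hasDerivAt.const_add
      (∫ x in a..b, h x c)).hasDerivWithinAt (s := Icc c d)
    rwa [projIcc_of_mem hcd hy] at this
  exact key.congr hprim (hprim y hy)

theorem memLp_restrict_Ioc_of_continuousOn {a b : ℝ} {f : ℝ → ℂ} (hf : ContinuousOn f (Icc a b)) :
    MemLp f 2 (volume.restrict (Ioc a b)) := by
  refine (memLp_two_iff_integrable_sq_norm ((hf.mono Ioc_subset_Icc_self).aestronglyMeasurable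
    measurableSet_Ioc)).2 ?_
  exact ((hf.norm.pow 2).integrableOn_compact isCompact_Icc).mono_set Ioc_subset_Icc_self

theorem continuousOn_fourierCoeffOn {X : Type*} [TopologicalSpace X] [FirstCountableTopology X]
    {a b : ℝ} (hab : a < b) {S : Set X} {h : ℝ → X → ℂ}
    (hh : ContinuousOn (fun p : ℝ × X => h p.1 p.2) (Icc a b ×ˢ S)) (l : ℤ) :
    ContinuousOn (fun p => fourierCoeffOn hab (fun x => h x p) l) S := by
  simp only [fourierCoeffOn_eq_integral]
  refine continuousOn_const.smul (continuousOn_intervalIntegral hab.le ?_)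
  have hc : Continuous fun p : ℝ × X => fourier (T := b - a) (-l) (p.1 : AddCircle (b - a)) :=
    (map_continuous (fourier (-l))).comp ((AddCircle.continuous_mk' (b - a)).comp continuous_fst)
  exact hc.continuousOn.smul hh

/-- Parseval's identity in the first variable, integrated over the second. -/
theorem hasSum_integral_sq_fourierCoeffOn {a b : ℝ} (hab : a < b) {h : ℝ → ℝ → ℂ}
    (hh : ContinuousOn (fun p : ℝ × ℝ => h p.1 p.2) (Icc a b ×ˢ Icc 0 1)) :
    HasSum (fun l : ℤ => ∫ y in (0 : ℝ)..1, ‖fourierCoeffOn hab (fun x => h x y) l‖ ^ 2)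
      (∫ y in (0 : ℝ)..1, (b - a)⁻¹ * ∫ x in a..b, ‖h x y‖ ^ 2) := by
  have pars : ∀ y ∈ Icc (0 : ℝ) 1, HasSum (fun l : ℤ => ‖fourierCoeffOn hab (fun x => h x y) l‖ ^ 2)
      ((b - a)⁻¹ * ∫ x in a..b, ‖h x y‖ ^ 2) := fun y hy =>
    hasSum_sq_fourierCoeffOn hab (memLp_restrict_Ioc_of_continuousOn (continuousOn_slice_left hh hy))
  have cN : ContinuousOn (fun y => (b - a)⁻¹ * ∫ x in a..b, ‖h x y‖ ^ 2) (Icc 0 1) :=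
    continuousOn_const.mul (continuousOn_intervalIntegral hab.le (hh.norm.pow 2))
  have hI : ∀ {y : ℝ}, y ∈ uIoc (0 : ℝ) 1 → y ∈ Icc (0 : ℝ) 1 := fun hy => by
    rw [uIoc_of_le zero_le_one] at hy
    exact Ioc_subset_Icc_self hy
  refine intervalIntegral.hasSum_integral_of_dominated_convergence
    (fun l y => ‖fourierCoeffOn hab (fun x => h x y) l‖ ^ 2) (fun l => ?_) (fun l => ?_) ?_ ?_ ?_
  · rw [uIoc_of_le zero_le_one]
    exact (((continuousOn_fourierCoeffOn hab hh l).norm.pow 2).mono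
      Ioc_subset_Icc_self).aestronglyMeasurable measurableSet_Ioc
  · exact Eventually.of_forall fun y _ => by rw [Real.norm_of_nonneg (by positivity)]
  · exact Eventually.of_forall fun y hy => (pars y (hI hy)).summable
  · refine (intervalIntegrable_of_continuousOn cN).congr fun y hy => ?_
    exact (pars y (hI hy)).tsum_eq.symm
  · exact Eventually.of_forall fun y hy => pars y (hI hy)

end Parametric

/-! ### Energy and decay of a single mode -/

theorem continuousOn_slab {h : ℝ → ℝ → ℂ} {a b : ℝ} (ha : 0 < a)
    (hh : ContinuousOn (fun p : ℝ × ℝ => h p.1 p.2) (Ioi 0 ×ˢ Icc 0 1)) :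
    ContinuousOn (fun p : ℝ × ℝ => h p.1 p.2) (Icc a b ×ˢ Icc 0 1) :=
  hh.mono (prod_mono (fun _ ht => ha.trans_le ht.1) le_rfl)

/-- `g` solves `∂_t g + i α b g = ν ∂_yy g` for `t > 0`, `y ∈ [0,1]`, the equation of a Fourier mode
in `x`. The derivatives `gt = ∂_t g`, `g1 = ∂_y g`, `g2 = ∂_yy g` are part of the data; `β j` stands
for `b^{(j)}`. The boundary conditions are Dirichlet, Neumann or periodic. -/
structure IsModeSolution (β : ℕ → ℝ → ℝ) (α ν : ℝ) (g gt g1 g2 : ℝ → ℝ → ℂ) : Prop where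
  cont : ContinuousOn (fun p : ℝ × ℝ => g p.1 p.2) (Ioi 0 ×ˢ Icc 0 1)
  cont_t : ContinuousOn (fun p : ℝ × ℝ => gt p.1 p.2) (Ioi 0 ×ˢ Icc 0 1)
  cont_y : ContinuousOn (fun p : ℝ × ℝ => g1 p.1 p.2) (Ioi 0 ×ˢ Icc 0 1)
  cont_yy : ContinuousOn (fun p : ℝ × ℝ => g2 p.1 p.2) (Ioi 0 ×ˢ Icc 0 1)
  deriv_t : ∀ t > 0, ∀ y ∈ Icc (0 : ℝ) 1, HasDerivAt (fun s => g s y) (gt t y) t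
  deriv_y : ∀ t > 0, ∀ y ∈ Icc (0 : ℝ) 1, HasDerivWithinAt (g t) (g1 t y) (Icc 0 1) y
  deriv_yy : ∀ t > 0, ∀ y ∈ Icc (0 : ℝ) 1, HasDerivWithinAt (g1 t) (g2 t y) (Icc 0 1) y
  equation : ∀ t > 0, ∀ y ∈ Icc (0 : ℝ) 1,
    gt t y + Complex.I * (α * β 0 y : ℝ) * g t y - (ν : ℂ) * g2 t y = 0
  boundary : (∀ t > 0, g t 0 = 0 ∧ g t 1 = 0) ∨ (∀ t > 0, g1 t 0 = 0 ∧ g1 t 1 = 0) ∨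
    ((∀ t > 0, g t 0 = g t 1 ∧ g1 t 0 = g1 t 1) ∧ ∀ j, β j 0 = β j 1)

namespace IsModeSolution

variable {β : ℕ → ℝ → ℝ} {α ν : ℝ} {g gt g1 g2 : ℝ → ℝ → ℂ}

theorem boundaryVanishes (hg : IsModeSolution β α ν g gt g1 g2) {t : ℝ} (ht : 0 < t) :
    BoundaryVanishes β (g t) (g1 t) := by
  rcases hg.boundary with h | h | ⟨h, hβ⟩
  · exact Or.inl ⟨Or.inl (h t ht).1, Or.inl (h t ht).2⟩
  · exact Or.inl ⟨Or.inr (h t ht).1, Or.inr (h t ht).2⟩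
  · exact Or.inr ⟨(h t ht).1, (h t ht).2, hβ⟩

/-- The energy of a mode never increases: the transport term is skew-adjoint. -/
theorem energy_le (hg : IsModeSolution β α ν g gt g1 g2) (hν : 0 ≤ ν) {a b : ℝ} (ha : 0 < a)
    (hab : a ≤ b) : ∫ y in (0 : ℝ)..1, ‖g b y‖ ^ 2 ≤ ∫ y in (0 : ℝ)..1, ‖g a y‖ ^ 2 := by
  have c0 := continuousOn_prod_swap (continuousOn_slab (b := b) ha hg.cont)
  have ct := continuousOn_prod_swap (continuousOn_slab (b := b) ha hg.cont_t)
  have ci : ContinuousOn (fun p : ℝ × ℝ => 2 * inner ℝ (g p.2 p.1) (gt p.2 p.1))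
      (Icc 0 1 ×ˢ Icc a b) := continuousOn_const.mul (c0.inner ct)
  have hd : ∀ t ∈ Icc a b, HasDerivWithinAt (fun t => ∫ y in (0 : ℝ)..1, ‖g t y‖ ^ 2)
      (∫ y in (0 : ℝ)..1, 2 * inner ℝ (g t y) (gt t y)) (Icc a b) t := fun t ht =>
    hasDerivWithinAt_intervalIntegral (h := fun y t => ‖g t y‖ ^ 2)
      (h' := fun y t => 2 * inner ℝ (g t y) (gt t y)) zero_le_one (c0.norm.pow 2) ci
      (fun y hy t ht => (hg.deriv_t t (ha.trans_le ht.1) y hy).hasDerivWithinAt.norm_sq) ht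
  have hftc := integral_eq_sub_of_hasDerivWithinAt_Icc hab hd
    (continuousOn_intervalIntegral (h := fun y t => 2 * inner ℝ (g t y) (gt t y)) zero_le_one ci)
  have hneg : ∀ t ∈ Icc a b, 0 ≤ -∫ y in (0 : ℝ)..1, 2 * inner ℝ (g t y) (gt t y) := by
    intro t ht
    have ht0 : 0 < t := ha.trans_le ht.1
    have e : ∫ y in (0 : ℝ)..1, 2 * inner ℝ (g t y) (gt t y) =
        (2 * ν) * ∫ y in (0 : ℝ)..1, inner ℝ (g t y) (g2 t y) := by
      rw [← intervalIntegral.integral_const_mul]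
      refine intervalIntegral.integral_congr fun y hy => ?_
      rw [uIcc_of_le zero_le_one] at hy
      have : gt t y = ν * g2 t y - Complex.I * (α * β 0 y : ℝ) * g t y := by
        linear_combination hg.equation t ht0 y hy
      rw [this]
      simp only [Complex.inner, Complex.mul_re, Complex.sub_re, Complex.conj_re, Complex.conj_im,
          Complex.sub_im, Complex.mul_im, Complex.I_re, Complex.I_im, Complex.ofReal_re,
          Complex.ofReal_im]
      ring
    rw [e, integral_inner_deriv_deriv_eq (hg.deriv_y t ht0) (hg.deriv_yy t ht0)
      (hg.cont_yy.comp (f := fun y => (t, y)) (by fun_prop) fun y hy => ⟨ht0, hy⟩)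
      (hg.boundaryVanishes ht0), mul_neg, neg_neg]
    exact mul_nonneg (by positivity)
      (intervalIntegral.integral_nonneg zero_le_one fun y _ => sq_nonneg _)
  have := intervalIntegral.integral_nonneg (μ := volume) hab hneg
  rw [intervalIntegral.integral_neg, hftc] at this
  linarith

end IsModeSolution

section WeightedCoeff

variable {X : Type*}

/-- The (unnormalised) Fourier coefficient over `[a, b]` of `t ↦ ψ(t) h(t, y)`. -/
noncomputable def weightedCoeff (a b : ℝ) (ψ : ℝ → ℝ) (h : ℝ → X → ℂ) (l : ℤ) (y : X) : ℂ :=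
  ∫ t in a..b, fourier (-l) (t : AddCircle (b - a)) * (ψ t * h t y)

theorem fourierCoeffOn_eq_weightedCoeff {a b : ℝ} (hab : a < b) (ψ : ℝ → ℝ) (h : ℝ → X → ℂ) (l : ℤ)
    (y : X) : fourierCoeffOn hab (fun t => ψ t * h t y) l = (1 / (b - a)) • weightedCoeff a b ψ h l y := by
  rw [fourierCoeffOn_eq_integral]
  rfl

theorem hasDerivAt_fourier_neg_mul {T : ℝ} (l : ℤ) {φ : ℝ → ℝ} {φ' : ℝ} {h : ℝ → ℂ} {h' : ℂ}
    {t : ℝ} (hφ : HasDerivAt φ φ' t) (hh : HasDerivAt h h' t) :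
    HasDerivAt (fun t : ℝ => fourier (-l) (t : AddCircle T) * (φ t * h t))
      (fourier (-l) (t : AddCircle T) * (φ' * h t) + fourier (-l) (t : AddCircle T) * (φ t * h')
        - Complex.I * (2 * Real.pi * l / T : ℝ) *
          (fourier (-l) (t : AddCircle T) * (φ t * h t))) t := by
  refine ((hasDerivAt_fourier_neg T l t).fun_mul (hφ.ofReal_comp.fun_mul hh)).congr_deriv ?_
  push_cast
  ring

theorem continuous_fourier_coe {T : ℝ} (l : ℤ) :
    Continuous fun t : ℝ => fourier l (t : AddCircle T) :=
  (map_continuous (fourier l)).comp (AddCircle.continuous_mk' T)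

theorem continuousOn_fourier_mul [TopologicalSpace X] {a b : ℝ} {ψ : ℝ → ℝ} {S : Set X} {h : ℝ → X → ℂ} (hψ : Continuous ψ)
    (hh : ContinuousOn (fun p : ℝ × X => h p.1 p.2) (Icc a b ×ˢ S)) (l : ℤ) :
    ContinuousOn (fun p : ℝ × X =>
      fourier (-l) (p.1 : AddCircle (b - a)) * (ψ p.1 * h p.1 p.2)) (Icc a b ×ˢ S) := by
  have h1 : Continuous fun p : ℝ × X => fourier (-l) (p.1 : AddCircle (b - a)) :=
    (continuous_fourier_coe (-l)).comp continuous_fst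
  have h2 : Continuous fun p : ℝ × X => (ψ p.1 : ℂ) := by fun_prop
  exact h1.continuousOn.mul (h2.continuousOn.mul hh)

theorem continuousOn_weightedCoeff [TopologicalSpace X] [FirstCountableTopology X] {a b : ℝ} (hab : a ≤ b) {ψ : ℝ → ℝ} {S : Set X} {h : ℝ → X → ℂ}
    (hψ : Continuous ψ)
    (hh : ContinuousOn (fun p : ℝ × X => h p.1 p.2) (Icc a b ×ˢ S)) (l : ℤ) :
    ContinuousOn (weightedCoeff a b ψ h l) (S) :=
  continuousOn_intervalIntegral hab (continuousOn_fourier_mul hψ hh l)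

theorem hasDerivWithinAt_weightedCoeff {a b c d : ℝ} (hab : a ≤ b) {ψ : ℝ → ℝ} {h h' : ℝ → ℝ → ℂ}
    (hψ : Continuous ψ)
    (hh : ContinuousOn (fun p : ℝ × ℝ => h p.1 p.2) (Icc a b ×ˢ Icc c d))
    (hh' : ContinuousOn (fun p : ℝ × ℝ => h' p.1 p.2) (Icc a b ×ˢ Icc c d))
    (hd : ∀ t ∈ Icc a b, ∀ y ∈ Icc c d, HasDerivWithinAt (h t) (h' t y) (Icc c d) y)
    (l : ℤ) {y : ℝ} (hy : y ∈ Icc c d) :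
    HasDerivWithinAt (weightedCoeff a b ψ h l) (weightedCoeff a b ψ h' l y) (Icc c d) y :=
  hasDerivWithinAt_intervalIntegral
    (h := fun (t : ℝ) y => fourier (-l) (t : AddCircle (b - a)) * (ψ t * h t y))
    (h' := fun (t : ℝ) y => fourier (-l) (t : AddCircle (b - a)) * (ψ t * h' t y)) hab
    (continuousOn_fourier_mul hψ hh l) (continuousOn_fourier_mul hψ hh' l)
    (fun t ht y hy => ((hd t ht y hy).const_mul _).const_mul _) hy

theorem weightedCoeff_congr {a b : ℝ} (hab : a ≤ b) {ψ : ℝ → ℝ} {h k : ℝ → X → ℂ} {y z : X}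
    (hhk : ∀ t ∈ Icc a b, h t y = k t z) (l : ℤ) :
    weightedCoeff a b ψ h l y = weightedCoeff a b ψ k l z := by
  refine intervalIntegral.integral_congr fun t ht => ?_
  rw [uIcc_of_le hab] at ht
  simp only [hhk t ht]

theorem weightedCoeff_zero {a b : ℝ} {ψ : ℝ → ℝ} {l : ℤ} {y : X} :
    weightedCoeff a b ψ (fun _ _ => 0) l y = 0 := by
  simp [weightedCoeff]

end WeightedCoeff

/-- The time-Fourier coefficients of `φ g`, for `φ` vanishing at both end points, solve the
resolvent equation with a right-hand side coming from `φ'`. -/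
theorem IsModeSolution.weightedCoeff_equation {β : ℕ → ℝ → ℝ} {α ν : ℝ} {g gt g1 g2 : ℝ → ℝ → ℂ}
    (hg : IsModeSolution β α ν g gt g1 g2) (hα : α ≠ 0) {a b : ℝ} (ha : 0 < a) (hab : a < b)
    {φ φ' : ℝ → ℝ} (dφ : ∀ t, HasDerivAt φ (φ' t) t) (cφ' : Continuous φ')
    (hφa : φ a = 0) (hφb : φ b = 0) (l : ℤ) {y : ℝ} (hy : y ∈ Icc (0 : ℝ) 1) :
    Complex.I * (α * (β 0 y - -(2 * Real.pi * l / (b - a)) / α) : ℝ) * weightedCoeff a b φ g l y -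
      (ν : ℂ) * weightedCoeff a b φ g2 l y = weightedCoeff a b φ' g l y := by
  have hpos : ∀ {t}, t ∈ Icc a b → 0 < t := fun ht => ha.trans_le ht.1
  have cφ : Continuous φ := continuous_iff_continuousAt.2 fun t => (dφ t).continuousAt
  have sl : ∀ (h : ℝ → ℝ → ℂ) {ψ : ℝ → ℝ}, Continuous ψ →
      ContinuousOn (fun p : ℝ × ℝ => h p.1 p.2) (Icc a b ×ˢ Icc 0 1) →
      ContinuousOn (fun t : ℝ => fourier (-l) (t : AddCircle (b - a)) * (ψ t * h t y)) (Icc a b) :=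
    fun h ψ hψ hh => continuousOn_slice_left
      (h := fun (t : ℝ) y => fourier (-l) (t : AddCircle (b - a)) * (ψ t * h t y))
      (continuousOn_fourier_mul hψ hh l) hy
  have ii : ∀ {h : ℝ → ℂ}, ContinuousOn h (Icc a b) → IntervalIntegrable h volume a b :=
    fun hh => ContinuousOn.intervalIntegrable (by rwa [uIcc_of_le hab.le])
  have s0 := sl g cφ (continuousOn_slab ha hg.cont)
  have s0' := sl g cφ' (continuousOn_slab ha hg.cont)
  have st := sl gt cφ (continuousOn_slab ha hg.cont_t)
  have s2 := sl g2 cφ (continuousOn_slab ha hg.cont_yy)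
  -- `φ` vanishes at both ends, so there is no boundary term in time
  have hftc := integral_eq_sub_of_hasDerivWithinAt_Icc hab.le
    (fun t ht => (hasDerivAt_fourier_neg_mul (T := b - a) l (dφ t)
      (hg.deriv_t t (hpos ht) y hy)).hasDerivWithinAt)
    ((s0'.add st).sub (continuousOn_const.mul s0))
  rw [hφa, hφb, intervalIntegral.integral_sub ((ii s0').add (ii st)) ((ii s0).const_mul _),
    intervalIntegral.integral_add (ii s0') (ii st),
    intervalIntegral.integral_const_mul] at hftc
  change weightedCoeff a b φ' g l y + weightedCoeff a b φ gt l y -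
    _ * weightedCoeff a b φ g l y = _ at hftc
  have heq : weightedCoeff a b φ gt l y =
      ν * weightedCoeff a b φ g2 l y - Complex.I * (α * β 0 y : ℝ) * weightedCoeff a b φ g l y := by
    simp only [weightedCoeff]
    rw [← intervalIntegral.integral_const_mul, ← intervalIntegral.integral_const_mul,
      ← intervalIntegral.integral_sub ((ii s2).const_mul _) ((ii s0).const_mul _)]
    refine intervalIntegral.integral_congr fun t ht => ?_
    rw [uIcc_of_le hab.le] at ht
    linear_combination fourier (-l) (t : AddCircle (b - a)) * φ t * hg.equation t (hpos ht) y hy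
  have hα' : α * (β 0 y - -(2 * Real.pi * l / (b - a)) / α) =
      α * β 0 y + 2 * Real.pi * l / (b - a) := by
    field_simp
    ring
  rw [heq] at hftc
  rw [hα', Complex.ofReal_add]
  simp only [Complex.ofReal_zero, zero_mul, mul_zero, sub_zero] at hftc
  linear_combination (-1 : ℂ) * hftc

theorem IsModeSolution.boundaryVanishes_weightedCoeff {β : ℕ → ℝ → ℝ} {α ν : ℝ}
    {g gt g1 g2 : ℝ → ℝ → ℂ} (hg : IsModeSolution β α ν g gt g1 g2) {a b : ℝ} (ha : 0 < a)
    (hab : a ≤ b) (φ : ℝ → ℝ) (l : ℤ) :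
    BoundaryVanishes β (weightedCoeff a b φ g l) (weightedCoeff a b φ g1 l) := by
  have zero : ∀ (h : ℝ → ℝ → ℂ) y, (∀ t > 0, h t y = 0) → weightedCoeff a b φ h l y = 0 :=
    fun h y hz => (weightedCoeff_congr (z := y) hab (fun t ht => hz t (ha.trans_le ht.1)) l).trans
      weightedCoeff_zero
  have same : ∀ (h : ℝ → ℝ → ℂ), (∀ t > 0, h t 0 = h t 1) →
      weightedCoeff a b φ h l 0 = weightedCoeff a b φ h l 1 :=
    fun h hz => weightedCoeff_congr hab (fun t ht => hz t (ha.trans_le ht.1)) l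
  rcases hg.boundary with h | h | ⟨h, hb⟩
  · exact Or.inl ⟨Or.inl (zero _ _ fun t ht => (h t ht).1),
      Or.inl (zero _ _ fun t ht => (h t ht).2)⟩
  · exact Or.inl ⟨Or.inr (zero _ _ fun t ht => (h t ht).1),
      Or.inr (zero _ _ fun t ht => (h t ht).2)⟩
  · exact Or.inr ⟨same _ fun t ht => (h t ht).1, same _ fun t ht => (h t ht).2, hb⟩

theorem integral_sq_parabola (a b : ℝ) :
    ∫ t in a..b, ((t - a) * (b - t)) ^ 2 = (b - a) ^ 5 / 30 := by
  rw [intervalIntegral.integral_eq_sub_of_hasDerivAt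
    (f := fun t => (b - a) ^ 2 * (t - a) ^ 3 / 3 - (b - a) * (t - a) ^ 4 / 2 + (t - a) ^ 5 / 5)
    (fun t _ => ?_) (Continuous.intervalIntegrable (by fun_prop) _ _)]
  · ring
  · have h1 := (hasDerivAt_id t).sub_const a
    refine (((((h1.pow 3).const_mul ((b - a) ^ 2)).div_const 3).sub
      (((h1.pow 4).const_mul (b - a)).div_const 2)).add ((h1.pow 5).div_const 5)).congr_deriv ?_
    simp
    ring

theorem integral_sq_deriv_parabola (a b : ℝ) :
    ∫ t in a..b, ((b - t) - (t - a)) ^ 2 = (b - a) ^ 3 / 3 := by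
  rw [intervalIntegral.integral_eq_sub_of_hasDerivAt
    (f := fun t => -((b - t) - (t - a)) ^ 3 / 6)
    (fun t _ => ?_) (Continuous.intervalIntegrable (by fun_prop) _ _)]
  · ring
  · have h1 := ((hasDerivAt_id t).const_sub b).sub ((hasDerivAt_id t).sub_const a)
    refine ((h1.pow 3).neg.div_const 6).congr_deriv ?_
    simp
    ring

/-- The Gearhart–Prüss mechanism: localising the solution in time by `φ(t) = (t - a)(b - t)` and
expanding in a Fourier series in `t`, a resolvent estimate with constant `q` gives
`q² ∫ φ² E ≤ ∫ φ'² E` for the energy `E`, hence a decay of `E` over `[a, b]`. -/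
theorem IsModeSolution.energy_decay {β : ℕ → ℝ → ℝ} {α ν q : ℝ} {g gt g1 g2 : ℝ → ℝ → ℂ}
    (hg : IsModeSolution β α ν g gt g1 g2) (hν : 0 ≤ ν) (hα : α ≠ 0)
    (hres : ∀ (μ : ℝ) (F F1 F2 G : ℝ → ℂ),
      (∀ y ∈ Icc (0 : ℝ) 1, HasDerivWithinAt F (F1 y) (Icc 0 1) y) →
      (∀ y ∈ Icc (0 : ℝ) 1, HasDerivWithinAt F1 (F2 y) (Icc 0 1) y) →
      ContinuousOn F2 (Icc 0 1) → BoundaryVanishes β F F1 →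
      (∀ y ∈ Icc (0 : ℝ) 1,
        Complex.I * (α * (β 0 y - μ) : ℝ) * F y - (ν : ℂ) * F2 y = G y) →
      q ^ 2 * ∫ y in (0 : ℝ)..1, ‖F y‖ ^ 2 ≤ ∫ y in (0 : ℝ)..1, ‖G y‖ ^ 2)
    {a b : ℝ} (ha : 0 < a) (hab : a < b) :
    q ^ 2 * (b - a) ^ 2 * ∫ y in (0 : ℝ)..1, ‖g b y‖ ^ 2 ≤
      10 * ∫ y in (0 : ℝ)..1, ‖g a y‖ ^ 2 := by
  have hT0 : 0 < b - a := sub_pos.2 hab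
  set φ : ℝ → ℝ := fun t => (t - a) * (b - t) with hφ
  set φ' : ℝ → ℝ := fun t => (b - t) - (t - a) with hφ'
  have dφ : ∀ t, HasDerivAt φ (φ' t) t := fun t => by
    refine (((hasDerivAt_id t).sub_const a).mul ((hasDerivAt_id t).const_sub b)).congr_deriv ?_
    simp [hφ']; ring
  have cφ : Continuous φ := by fun_prop
  have cφ' : Continuous φ' := by fun_prop
  have c0 := continuousOn_slab (b := b) ha hg.cont
  have c1 := continuousOn_slab (b := b) ha hg.cont_y
  have c2 := continuousOn_slab (b := b) ha hg.cont_yy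
  have hmode : ∀ l : ℤ, q ^ 2 * ∫ y in (0 : ℝ)..1, ‖weightedCoeff a b φ g l y‖ ^ 2 ≤
      ∫ y in (0 : ℝ)..1, ‖weightedCoeff a b φ' g l y‖ ^ 2 := by
    intro l
    refine hres (-(2 * Real.pi * l / (b - a)) / α) (weightedCoeff a b φ g l) (weightedCoeff a b φ g1 l)
      (weightedCoeff a b φ g2 l) (weightedCoeff a b φ' g l)
      (fun y hy => hasDerivWithinAt_weightedCoeff hab.le cφ c0 c1
        (fun t ht => hg.deriv_y t (ha.trans_le ht.1)) l hy)
      (fun y hy => hasDerivWithinAt_weightedCoeff hab.le cφ c1 c2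
        (fun t ht => hg.deriv_yy t (ha.trans_le ht.1)) l hy)
      (continuousOn_weightedCoeff hab.le cφ c2 l) (hg.boundaryVanishes_weightedCoeff ha hab.le φ l)
      (fun y hy => hg.weightedCoeff_equation hα ha hab dφ cφ' (by simp [hφ]) (by simp [hφ]) l hy)
  -- summation over the time frequencies
  have cE : ContinuousOn (fun t => ∫ y in (0 : ℝ)..1, ‖g t y‖ ^ 2) (Icc a b) :=
    continuousOn_intervalIntegral (h := fun y t => ‖g t y‖ ^ 2) zero_le_one
      ((continuousOn_prod_swap c0).norm.pow 2)
  have pars : ∀ {ψ : ℝ → ℝ}, Continuous ψ →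
      HasSum (fun l : ℤ => ∫ y in (0 : ℝ)..1, ‖weightedCoeff a b ψ g l y‖ ^ 2)
        ((b - a) * ∫ t in a..b, ψ t ^ 2 * ∫ y in (0 : ℝ)..1, ‖g t y‖ ^ 2) := by
    intro ψ hψ
    have cψ : ContinuousOn (fun p : ℝ × ℝ => (ψ p.1 : ℂ) * g p.1 p.2) (Icc a b ×ˢ Icc 0 1) := by
      have : Continuous fun p : ℝ × ℝ => (ψ p.1 : ℂ) := by fun_prop
      exact this.continuousOn.mul c0
    have h := (hasSum_integral_sq_fourierCoeffOn hab (h := fun t y => (ψ t : ℂ) * g t y)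
      cψ).mul_left ((b - a) ^ 2)
    simp only [fourierCoeffOn_eq_weightedCoeff, intervalIntegral.integral_const_mul] at h
    rw [← intervalIntegral_swap_of_continuousOn (h := fun t y => ‖(ψ t : ℂ) * g t y‖ ^ 2) hab.le
      zero_le_one (cψ.norm.pow 2)] at h
    have e1 : ∀ l : ℤ, (b - a) ^ 2 *
        ∫ y in (0 : ℝ)..1, ‖(1 / (b - a)) • weightedCoeff a b ψ g l y‖ ^ 2 =
        ∫ y in (0 : ℝ)..1, ‖weightedCoeff a b ψ g l y‖ ^ 2 := by
      intro l
      rw [← intervalIntegral.integral_const_mul]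
      congr 1
      funext y
      rw [norm_smul, Real.norm_of_nonneg (by positivity)]
      field_simp
    have e2 : (b - a) ^ 2 * ((b - a)⁻¹ *
        ∫ t in a..b, ∫ y in (0 : ℝ)..1, ‖(ψ t : ℂ) * g t y‖ ^ 2) =
        (b - a) * ∫ t in a..b, ψ t ^ 2 * ∫ y in (0 : ℝ)..1, ‖g t y‖ ^ 2 := by
      simp only [norm_mul, mul_pow, Complex.norm_real, Real.norm_eq_abs, sq_abs,
        intervalIntegral.integral_const_mul]
      field_simp
    simp only [e1] at h
    rwa [e2] at h
  have hle := hasSum_le hmode ((pars cφ).mul_left (q ^ 2)) (pars cφ')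
  have lower : (∫ y in (0 : ℝ)..1, ‖g b y‖ ^ 2) * ((b - a) ^ 5 / 30) ≤
      ∫ t in a..b, φ t ^ 2 * ∫ y in (0 : ℝ)..1, ‖g t y‖ ^ 2 := by
    rw [← integral_sq_parabola, ← intervalIntegral.integral_const_mul]
    refine intervalIntegral.integral_mono_on hab.le
      (Continuous.intervalIntegrable (by fun_prop) _ _)
      (ContinuousOn.intervalIntegrable (by rw [uIcc_of_le hab.le]; fun_prop)) fun t ht => ?_
    rw [mul_comm]
    exact mul_le_mul_of_nonneg_left (hg.energy_le hν (ha.trans_le ht.1) ht.2) (sq_nonneg _)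
  have upper : ∫ t in a..b, φ' t ^ 2 * ∫ y in (0 : ℝ)..1, ‖g t y‖ ^ 2 ≤
      (∫ y in (0 : ℝ)..1, ‖g a y‖ ^ 2) * ((b - a) ^ 3 / 3) := by
    rw [← integral_sq_deriv_parabola, ← intervalIntegral.integral_const_mul]
    refine intervalIntegral.integral_mono_on hab.le
      (ContinuousOn.intervalIntegrable (by rw [uIcc_of_le hab.le]; fun_prop))
      (Continuous.intervalIntegrable (by fun_prop) _ _) fun t ht => ?_
    rw [mul_comm]
    exact mul_le_mul_of_nonneg_right (hg.energy_le hν ha ht.1) (sq_nonneg _)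
  set Ea := ∫ y in (0 : ℝ)..1, ‖g a y‖ ^ 2
  set Eb := ∫ y in (0 : ℝ)..1, ‖g b y‖ ^ 2
  have h1 : q ^ 2 * ((b - a) * (Eb * ((b - a) ^ 5 / 30))) ≤
      (b - a) * (Ea * ((b - a) ^ 3 / 3)) :=
    (by gcongr : _ ≤ _).trans (hle.trans (by gcongr))
  have h2 : (b - a) ^ 4 / 30 * (q ^ 2 * (b - a) ^ 2 * Eb) ≤ (b - a) ^ 4 / 30 * (10 * Ea) := by
    linarith
  exact le_of_mul_le_mul_left h2 (by positivity)

/-! ### Partial derivatives and Fourier modes in `x` -/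

theorem CrossSection.uniqueDiffOn_closure (D : CrossSection) : UniqueDiffOn ℝ D.closure := by
  cases D
  · exact uniqueDiffOn_univ
  · exact uniqueDiffOn_Icc zero_lt_one

theorem CrossSection.Icc_subset_closure (D : CrossSection) : Icc 0 1 ⊆ D.closure := by
  cases D
  · exact subset_univ _
  · exact subset_rfl

theorem CrossSection.domain_subset_closure (D : CrossSection) : D.domain ⊆ D.closure := by
  cases D
  · exact subset_rfl
  · exact Ioo_subset_Icc_self

theorem CrossSection.closure_subset_closure_domain (D : CrossSection) :
    D.closure ⊆ _root_.closure D.domain := by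
  cases D
  · simp [CrossSection.domain]
  · simp [CrossSection.domain, CrossSection.closure, closure_Ioo]

theorem CrossSection.isOpen_domain (D : CrossSection) : IsOpen D.domain := by
  cases D
  · exact isOpen_univ
  · exact isOpen_Ioo

/-- The closed space-time domain, up to the initial time. -/
def CrossSection.spaceTime (D : CrossSection) : Set (ℝ × ℝ × ℝ) := Ioi 0 ×ˢ (univ ×ˢ D.closure)

theorem CrossSection.uniqueDiffOn_spaceTime (D : CrossSection) : UniqueDiffOn ℝ D.spaceTime :=
  isOpen_Ioi.uniqueDiffOn.prod (uniqueDiffOn_univ.prod D.uniqueDiffOn_closure)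

/-- The directional derivative of `φ`, relative to the space-time domain. -/
noncomputable def dirDeriv (D : CrossSection) (v : ℝ × ℝ × ℝ) (φ : ℝ × ℝ × ℝ → ℝ)
    (p : ℝ × ℝ × ℝ) : ℝ :=
  fderivWithin ℝ φ D.spaceTime p v

theorem contDiffOn_dirDeriv {D : CrossSection} {φ : ℝ × ℝ × ℝ → ℝ}
    (hφ : ContDiffOn ℝ ∞ φ D.spaceTime) (v : ℝ × ℝ × ℝ) :
    ContDiffOn ℝ ∞ (dirDeriv D v φ) D.spaceTime :=
  (hφ.fderivWithin D.uniqueDiffOn_spaceTime (m := ∞) (by simp)).clm_apply contDiffOn_const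

theorem hasDerivWithinAt_comp_dirDeriv {D : CrossSection} {φ : ℝ × ℝ × ℝ → ℝ}
    (hφ : ContDiffOn ℝ ∞ φ D.spaceTime) {γ : ℝ → ℝ × ℝ × ℝ} {v : ℝ × ℝ × ℝ} {s : Set ℝ} {τ : ℝ}
    (hγ : HasDerivWithinAt γ v s τ) (hs : MapsTo γ s D.spaceTime) (hτ : τ ∈ s) :
    HasDerivWithinAt (fun z => φ (γ z)) (dirDeriv D v φ (γ τ)) s τ :=
  ((hφ.differentiableOn (by simp) (γ τ) (hs hτ)).hasFDerivWithinAt).comp_hasDerivWithinAt τ hγ hs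

section Lines

variable {D : CrossSection} {φ : ℝ × ℝ × ℝ → ℝ} {t x y : ℝ}

theorem hasDerivAt_time (hφ : ContDiffOn ℝ ∞ φ D.spaceTime) (ht : 0 < t) (hy : y ∈ D.closure) :
    HasDerivAt (fun s => φ (s, x, y)) (dirDeriv D (1, 0, 0) φ (t, x, y)) t := by
  refine (hasDerivWithinAt_comp_dirDeriv hφ (γ := fun s => (s, x, y)) (s := Ioi 0) ?_
    (fun s hs => ⟨hs, mem_univ _, hy⟩) ht).hasDerivAt (Ioi_mem_nhds ht)
  exact ((hasDerivAt_id t).prodMk ((hasDerivAt_const t x).prodMk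
    (hasDerivAt_const t y))).hasDerivWithinAt

theorem hasDerivAt_x (hφ : ContDiffOn ℝ ∞ φ D.spaceTime) (ht : 0 < t) (hy : y ∈ D.closure) :
    HasDerivAt (fun z => φ (t, z, y)) (dirDeriv D (0, 1, 0) φ (t, x, y)) x := by
  refine (hasDerivWithinAt_comp_dirDeriv hφ (γ := fun z => (t, z, y)) (s := univ) ?_
    (fun s _ => ⟨ht, mem_univ _, hy⟩) (mem_univ x)).hasDerivAt univ_mem
  exact ((hasDerivAt_const x t).prodMk ((hasDerivAt_id x).prodMk
    (hasDerivAt_const x y))).hasDerivWithinAt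

theorem hasDerivWithinAt_y (hφ : ContDiffOn ℝ ∞ φ D.spaceTime) (ht : 0 < t) (hy : y ∈ D.closure) :
    HasDerivWithinAt (fun z => φ (t, x, z)) (dirDeriv D (0, 0, 1) φ (t, x, y)) D.closure y := by
  refine hasDerivWithinAt_comp_dirDeriv hφ (γ := fun z => (t, x, z)) (s := D.closure) ?_
    (fun s hs => ⟨ht, mem_univ _, hs⟩) hy
  exact ((hasDerivAt_const y t).prodMk ((hasDerivAt_const y x).prodMk
    (hasDerivAt_id y))).hasDerivWithinAt

end Lines

/-- The successive derivatives of the profile. -/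
noncomputable def profileDeriv (D : CrossSection) (b : ℝ → ℝ) (j : ℕ) : ℝ → ℝ :=
  iteratedDerivWithin j b D.closure

theorem profileDeriv_zero (D : CrossSection) (b : ℝ → ℝ) : profileDeriv D b 0 = b :=
  iteratedDerivWithin_zero

theorem IsSmoothProfile.hasDerivWithinAt {D : CrossSection} {b : ℝ → ℝ} (hb : IsSmoothProfile D b)
    (j : ℕ) {y : ℝ} (hy : y ∈ Icc (0 : ℝ) 1) :
    HasDerivWithinAt (profileDeriv D b j) (profileDeriv D b (j + 1) y) (Icc 0 1) y := by
  have h := (hb.smooth.differentiableOn_iteratedDerivWithin (m := j)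
    (by exact_mod_cast WithTop.coe_lt_coe.2 (ENat.natCast_lt_top j)) D.uniqueDiffOn_closure) y
    (D.Icc_subset_closure hy)
  have h' := h.hasDerivWithinAt
  rw [← iteratedDerivWithin_succ] at h'
  exact h'.mono D.Icc_subset_closure

theorem IsSmoothProfile.periodic_profileDeriv {b : ℝ → ℝ} (hb : IsSmoothProfile .torus b) (j : ℕ) :
    Function.Periodic (profileDeriv .torus b j) 1 := by
  intro y
  have h := iteratedDeriv_comp_add_const j b 1
  have e : (fun z => b (z + 1)) = b := funext hb.descends
  rw [e] at h
  have := congrFun h y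
  simp only [profileDeriv, CrossSection.closure, iteratedDerivWithin_univ]
  exact this.symm

/-- The `k`-th Fourier mode in `x` of `φ(t, x, y)`. -/
noncomputable def xMode (φ : ℝ × ℝ × ℝ → ℝ) (k : ℤ) (t y : ℝ) : ℂ :=
  weightedCoeff 0 1 (fun _ => 1) (fun x (p : ℝ × ℝ) => (φ (p.1, x, p.2) : ℂ)) k (t, y)

theorem continuousOn_xMode_integrand {D : CrossSection} {φ : ℝ × ℝ × ℝ → ℝ}
    (hφ : ContinuousOn φ D.spaceTime) :
    ContinuousOn (fun q : ℝ × (ℝ × ℝ) => (φ (q.2.1, q.1, q.2.2) : ℂ))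
      (Icc 0 1 ×ˢ (Ioi 0 ×ˢ Icc 0 1)) := by
  refine Complex.continuous_ofReal.comp_continuousOn
    (hφ.comp (f := fun q : ℝ × (ℝ × ℝ) => (q.2.1, q.1, q.2.2)) (by fun_prop) ?_)
  exact fun q hq => ⟨hq.2.1, mem_univ _, D.Icc_subset_closure hq.2.2⟩

theorem continuousOn_xMode {D : CrossSection} {φ : ℝ × ℝ × ℝ → ℝ}
    (hφ : ContinuousOn φ D.spaceTime) (k : ℤ) :
    ContinuousOn (fun p : ℝ × ℝ => xMode φ k p.1 p.2) (Ioi 0 ×ˢ Icc 0 1) :=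
  continuousOn_weightedCoeff (h := fun x (p : ℝ × ℝ) => (φ (p.1, x, p.2) : ℂ)) zero_le_one
    continuous_const (continuousOn_xMode_integrand hφ) k

theorem hasDerivAt_xMode_time {D : CrossSection} {φ : ℝ × ℝ × ℝ → ℝ}
    (hφ : ContDiffOn ℝ ∞ φ D.spaceTime) (k : ℤ) {t y : ℝ} (ht : 0 < t) (hy : y ∈ Icc (0 : ℝ) 1) :
    HasDerivAt (fun s => xMode φ k s y) (xMode (dirDeriv D (1, 0, 0) φ) k t y) t := by
  have hI : ∀ s ∈ Icc (t / 2) (2 * t), 0 < s := fun s hs => by linarith [hs.1]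
  have aux : ∀ {ψ : ℝ × ℝ × ℝ → ℝ}, ContDiffOn ℝ ∞ ψ D.spaceTime →
      ContinuousOn (fun q : ℝ × ℝ => (ψ (q.2, q.1, y) : ℂ)) (Icc 0 1 ×ˢ Icc (t / 2) (2 * t)) :=
    fun hψ => (continuousOn_xMode_integrand hψ.continuousOn).comp
      (f := fun q : ℝ × ℝ => (q.1, (q.2, y))) (by fun_prop)
      fun q hq => ⟨hq.1, hI _ hq.2, hy⟩
  have := hasDerivWithinAt_weightedCoeff (a := 0) (b := 1) (ψ := fun _ => 1)
    (h := fun x s => (φ (s, x, y) : ℂ)) (h' := fun x s => (dirDeriv D (1, 0, 0) φ (s, x, y) : ℂ))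
    zero_le_one continuous_const (aux hφ) (aux (contDiffOn_dirDeriv hφ _))
    (fun x _ s hs => (hasDerivAt_time hφ (hI s hs)
      (D.Icc_subset_closure hy)).ofReal_comp.hasDerivWithinAt) k
    (y := t) ⟨by linarith, by linarith⟩
  exact this.hasDerivAt (Icc_mem_nhds (by linarith) (by linarith))

theorem hasDerivWithinAt_xMode {D : CrossSection} {φ : ℝ × ℝ × ℝ → ℝ}
    (hφ : ContDiffOn ℝ ∞ φ D.spaceTime) (k : ℤ) {t y : ℝ} (ht : 0 < t) (hy : y ∈ Icc (0 : ℝ) 1) :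
    HasDerivWithinAt (xMode φ k t) (xMode (dirDeriv D (0, 0, 1) φ) k t y) (Icc 0 1) y := by
  have aux : ∀ {ψ : ℝ × ℝ × ℝ → ℝ}, ContDiffOn ℝ ∞ ψ D.spaceTime →
      ContinuousOn (fun q : ℝ × ℝ => (ψ (t, q.1, q.2) : ℂ)) (Icc 0 1 ×ˢ Icc 0 1) :=
    fun hψ => (continuousOn_xMode_integrand hψ.continuousOn).comp
      (f := fun q : ℝ × ℝ => (q.1, (t, q.2))) (by fun_prop)
      fun q hq => ⟨hq.1, ht, hq.2⟩
  exact hasDerivWithinAt_weightedCoeff (a := 0) (b := 1) (ψ := fun _ => 1)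
    (h := fun x z => (φ (t, x, z) : ℂ)) (h' := fun x z => (dirDeriv D (0, 0, 1) φ (t, x, z) : ℂ))
    zero_le_one continuous_const (aux hφ) (aux (contDiffOn_dirDeriv hφ _))
    (fun x _ z hz => ((hasDerivWithinAt_y hφ ht
      (D.Icc_subset_closure hz)).mono D.Icc_subset_closure).ofReal_comp) k hy

theorem continuousOn_xMode_slice {D : CrossSection} {φ : ℝ × ℝ × ℝ → ℝ}
    (hφ : ContinuousOn φ D.spaceTime) (k : ℤ) {t y : ℝ} (ht : 0 < t) (hy : y ∈ Icc (0 : ℝ) 1) :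
    ContinuousOn (fun x : ℝ => fourier (-k) (x : AddCircle ((1 : ℝ) - 0)) *
      (((1 : ℝ) : ℂ) * (φ (t, x, y) : ℂ))) (Icc 0 1) := by
  have h1 : ContinuousOn (fun x => (φ (t, x, y) : ℂ)) (Icc 0 1) :=
    (continuousOn_xMode_integrand hφ).comp (f := fun x => (x, (t, y))) (by fun_prop)
      fun x hx => ⟨hx, ht, hy⟩
  exact (continuous_fourier_coe (-k)).continuousOn.mul (continuousOn_const.mul h1)

/-- Integration by parts in `x`: the mode of `∂_x φ` is `2πik` times the mode of `φ`. -/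
theorem xMode_dirDeriv_x {D : CrossSection} {φ : ℝ × ℝ × ℝ → ℝ}
    (hφ : ContDiffOn ℝ ∞ φ D.spaceTime) (k : ℤ) {t y : ℝ} (ht : 0 < t) (hy : y ∈ Icc (0 : ℝ) 1)
    (hper : Function.Periodic (fun x => φ (t, x, y)) 1) :
    xMode (dirDeriv D (0, 1, 0) φ) k t y = Complex.I * (2 * Real.pi * k : ℝ) * xMode φ k t y := by
  have c0 := continuousOn_xMode_slice hφ.continuousOn k ht hy
  have c1 := continuousOn_xMode_slice (contDiffOn_dirDeriv hφ (0, 1, 0)).continuousOn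
    k ht hy
  have hftc := integral_eq_sub_of_hasDerivWithinAt_Icc zero_le_one
    (fun x _ => (hasDerivAt_fourier_neg_mul (T := 1 - 0) k (hasDerivAt_const x (1 : ℝ))
      (hasDerivAt_x hφ ht (D.Icc_subset_closure hy)).ofReal_comp).hasDerivWithinAt)
    (((continuousOn_const (c := (0 : ℂ))).congr (fun x _ => by simp) |>.add c1).sub
      (continuousOn_const.mul c0))
  have hp : φ (t, 1, y) = φ (t, 0, y) := by simpa using hper 0
  have hper1 : (((1 : ℝ) : AddCircle ((1 : ℝ) - 0))) = ((0 : ℝ) : AddCircle ((1 : ℝ) - 0)) := by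
    simp
  simp only [Complex.ofReal_zero, zero_mul, mul_zero, zero_add] at hftc
  rw [hp, hper1, sub_self, intervalIntegral.integral_sub (intervalIntegrable_of_continuousOn c1)
    ((intervalIntegrable_of_continuousOn c0).const_mul _),
    intervalIntegral.integral_const_mul] at hftc
  have h2 : (2 * Real.pi * k / (1 - 0) : ℝ) = 2 * Real.pi * k := by ring
  rw [h2] at hftc
  exact sub_eq_zero.1 hftc

/-! ### The equation for the modes -/

section

variable {D : CrossSection} {bc : BoundaryCondition D} {b : ℝ → ℝ} {ν : ℝ} {f₀ : ℝ → ℝ → ℝ}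
  {f : ℝ → ℝ → ℝ → ℝ}

/-- A function of `t`, `x`, `y` as a function on the product. -/
def uncurry₃ (f : ℝ → ℝ → ℝ → ℝ) (p : ℝ × ℝ × ℝ) : ℝ := f p.1 p.2.1 p.2.2

theorem IsSolution.contDiffOn (hf : IsSolution bc b ν f₀ f) :
    ContDiffOn ℝ ∞ (uncurry₃ f) D.spaceTime := hf.smooth

/-- The equation, extended by continuity to the end points of the cross-section. -/
theorem IsSolution.equation_closure (hb : IsSmoothProfile D b) (hf : IsSolution bc b ν f₀ f)
    {t x y : ℝ} (ht : 0 < t) (hy : y ∈ D.closure) :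
    dirDeriv D (1, 0, 0) (uncurry₃ f) (t, x, y) +
      b y * dirDeriv D (0, 1, 0) (uncurry₃ f) (t, x, y) -
      ν * dirDeriv D (0, 0, 1) (dirDeriv D (0, 0, 1) (uncurry₃ f)) (t, x, y) = 0 := by
  have hφ := hf.contDiffOn
  have line : ∀ {ψ : ℝ × ℝ × ℝ → ℝ}, ContDiffOn ℝ ∞ ψ D.spaceTime →
      ContinuousOn (fun z => ψ (t, x, z)) D.closure := fun hψ =>
    hψ.continuousOn.comp (by fun_prop) fun z hz => ⟨ht, mem_univ _, hz⟩
  have hEq : EqOn (fun y => dirDeriv D (1, 0, 0) (uncurry₃ f) (t, x, y) +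
      b y * dirDeriv D (0, 1, 0) (uncurry₃ f) (t, x, y) -
      ν * dirDeriv D (0, 0, 1) (dirDeriv D (0, 0, 1) (uncurry₃ f)) (t, x, y)) (fun _ => 0)
      D.domain := by
    intro z hz
    have hzc := D.domain_subset_closure hz
    have e := hf.equation t ht x z hz
    have h1 : deriv (fun s => f s x z) t = dirDeriv D (1, 0, 0) (uncurry₃ f) (t, x, z) :=
      (hasDerivAt_time hφ ht hzc).deriv
    have h2 : deriv (fun w => f t w z) x = dirDeriv D (0, 1, 0) (uncurry₃ f) (t, x, z) :=
      (hasDerivAt_x hφ ht hzc).deriv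
    have hnear : ∀ w ∈ D.domain, D.closure ∈ 𝓝 w := fun w hw =>
      mem_of_superset (D.isOpen_domain.mem_nhds hw) D.domain_subset_closure
    have h3 : iteratedDeriv 2 (fun w => f t x w) z =
        dirDeriv D (0, 0, 1) (dirDeriv D (0, 0, 1) (uncurry₃ f)) (t, x, z) := by
      rw [iteratedDeriv_succ, iteratedDeriv_one]
      have : deriv (fun w => f t x w) =ᶠ[𝓝 z]
          fun w => dirDeriv D (0, 0, 1) (uncurry₃ f) (t, x, w) := by
        filter_upwards [D.isOpen_domain.mem_nhds hz] with w hw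
        exact ((hasDerivWithinAt_y hφ ht (D.domain_subset_closure hw)).hasDerivAt
          (hnear w hw)).deriv
      rw [this.deriv_eq]
      exact ((hasDerivWithinAt_y (contDiffOn_dirDeriv hφ _) ht hzc).hasDerivAt (hnear z hz)).deriv
    rw [h1, h2, h3] at e
    exact e
  refine hEq.of_subset_closure ?_ continuousOn_const D.domain_subset_closure
    D.closure_subset_closure_domain hy
  exact ((line (contDiffOn_dirDeriv hφ _)).add
    (hb.smooth.continuousOn.mul (line (contDiffOn_dirDeriv hφ _)))).sub
    (continuousOn_const.mul (line (contDiffOn_dirDeriv (contDiffOn_dirDeriv hφ _) _)))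

theorem xMode_congr {φ ψ : ℝ × ℝ × ℝ → ℝ} {k : ℤ} {t y z : ℝ}
    (h : ∀ x, φ (t, x, y) = ψ (t, x, z)) : xMode φ k t y = xMode ψ k t z :=
  weightedCoeff_congr zero_le_one (fun x _ => by simp only [h x]) k

theorem xMode_eq_zero {φ : ℝ × ℝ × ℝ → ℝ} {k : ℤ} {t y : ℝ}
    (h : ∀ x, φ (t, x, y) = 0) : xMode φ k t y = 0 := by
  rw [xMode_congr (ψ := fun _ => 0) (z := y) h]
  simp [xMode, weightedCoeff]

theorem IsSolution.mode_boundary (hb : IsSmoothProfile D b) (hf : IsSolution bc b ν f₀ f) (k : ℤ) :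
    (∀ t > 0, xMode (uncurry₃ f) k t 0 = 0 ∧ xMode (uncurry₃ f) k t 1 = 0) ∨
    (∀ t > 0, xMode (dirDeriv D (0, 0, 1) (uncurry₃ f)) k t 0 = 0 ∧
      xMode (dirDeriv D (0, 0, 1) (uncurry₃ f)) k t 1 = 0) ∨
    ((∀ t > 0, xMode (uncurry₃ f) k t 0 = xMode (uncurry₃ f) k t 1 ∧
      xMode (dirDeriv D (0, 0, 1) (uncurry₃ f)) k t 0 =
        xMode (dirDeriv D (0, 0, 1) (uncurry₃ f)) k t 1) ∧
      ∀ j, profileDeriv D b j 0 = profileDeriv D b j 1) := by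
  have hφ := hf.contDiffOn
  cases bc with
  | dirichlet =>
    exact Or.inl fun t ht => ⟨xMode_eq_zero fun x => (hf.boundary t ht x).1,
      xMode_eq_zero fun x => (hf.boundary t ht x).2⟩
  | neumann =>
    refine Or.inr (Or.inl fun t ht => ?_)
    have hd : ∀ x, ∀ y ∈ Icc (0 : ℝ) 1, derivWithin (f t x) (Icc 0 1) y =
        dirDeriv .interval (0, 0, 1) (uncurry₃ f) (t, x, y) := fun x y hy =>
      (hasDerivWithinAt_y hφ ht hy).derivWithin (uniqueDiffOn_Icc zero_lt_one y hy)
    exact ⟨xMode_eq_zero fun x => (hd x 0 (by simp)).symm.trans (hf.boundary t ht x).1,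
      xMode_eq_zero fun x => (hd x 1 (by simp)).symm.trans (hf.boundary t ht x).2⟩
  | periodic =>
    refine Or.inr (Or.inr ⟨fun t ht => ?_, fun j => ?_⟩)
    · have hp : ∀ x, f t x 0 = f t x 1 := fun x => by
        simpa using (hf.boundary t ht x 0).symm
      have hd : ∀ x y, HasDerivAt (f t x)
          (dirDeriv .torus (0, 0, 1) (uncurry₃ f) (t, x, y)) y := fun x y =>
        (hasDerivWithinAt_y (D := .torus) hφ ht (mem_univ y)).hasDerivAt univ_mem
      refine ⟨xMode_congr hp, xMode_congr fun x => ?_⟩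
      have h1 : HasDerivAt (fun z => f t x (z + 1))
          (dirDeriv .torus (0, 0, 1) (uncurry₃ f) (t, x, 1)) 0 := by
        refine HasDerivAt.comp_add_const 0 1 ?_
        simpa using hd x 1
      have e : (fun z => f t x (z + 1)) = f t x := funext (hf.boundary t ht x)
      rw [e] at h1
      exact (hd x 0).unique h1
    · simpa using (hb.periodic_profileDeriv j 0).symm

theorem IsSolution.isModeSolution (hb : IsSmoothProfile D b) (hf : IsSolution bc b ν f₀ f)
    (k : ℤ) :
    IsModeSolution (profileDeriv D b) (2 * Real.pi * k) ν (xMode (uncurry₃ f) k)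
      (xMode (dirDeriv D (1, 0, 0) (uncurry₃ f)) k) (xMode (dirDeriv D (0, 0, 1) (uncurry₃ f)) k)
      (xMode (dirDeriv D (0, 0, 1) (dirDeriv D (0, 0, 1) (uncurry₃ f))) k) := by
  have hφ := hf.contDiffOn
  have hφt := contDiffOn_dirDeriv hφ (1, 0, 0)
  have hφx := contDiffOn_dirDeriv hφ (0, 1, 0)
  have hφy := contDiffOn_dirDeriv hφ (0, 0, 1)
  have hφyy := contDiffOn_dirDeriv hφy (0, 0, 1)
  refine ⟨continuousOn_xMode hφ.continuousOn k, continuousOn_xMode hφt.continuousOn k,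
    continuousOn_xMode hφy.continuousOn k, continuousOn_xMode hφyy.continuousOn k,
    fun t ht y hy => hasDerivAt_xMode_time hφ k ht hy,
    fun t ht y hy => hasDerivWithinAt_xMode hφ k ht hy,
    fun t ht y hy => hasDerivWithinAt_xMode hφy k ht hy, fun t ht y hy => ?_,
    hf.mode_boundary hb k⟩
  have hx := xMode_dirDeriv_x hφ k ht hy (hf.periodic_x t ht y (D.Icc_subset_closure hy))
  have it := intervalIntegrable_of_continuousOn (continuousOn_xMode_slice hφt.continuousOn k ht hy)
  have ix := intervalIntegrable_of_continuousOn (continuousOn_xMode_slice hφx.continuousOn k ht hy)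
  have iyy := intervalIntegrable_of_continuousOn
    (continuousOn_xMode_slice hφyy.continuousOn k ht hy)
  have hsum : xMode (dirDeriv D (1, 0, 0) (uncurry₃ f)) k t y +
      (b y : ℂ) * xMode (dirDeriv D (0, 1, 0) (uncurry₃ f)) k t y -
      (ν : ℂ) * xMode (dirDeriv D (0, 0, 1) (dirDeriv D (0, 0, 1) (uncurry₃ f))) k t y = 0 := by
    simp only [xMode, weightedCoeff]
    rw [← intervalIntegral.integral_const_mul, ← intervalIntegral.integral_const_mul,
      ← intervalIntegral.integral_add it (ix.const_mul _),
      ← intervalIntegral.integral_sub (it.add (ix.const_mul _)) (iyy.const_mul _)]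
    refine (intervalIntegral.integral_congr (g := fun _ => (0 : ℂ)) fun x _ => ?_).trans (by simp)
    have e := congrArg (fun r : ℝ => (r : ℂ))
      (hf.equation_closure hb (x := x) ht (D.Icc_subset_closure hy))
    push_cast at e
    simp only [Complex.ofReal_one]
    linear_combination fourier (-k) (x : AddCircle ((1 : ℝ) - 0)) * e
  rw [hx] at hsum
  rw [profileDeriv_zero]
  push_cast at hsum ⊢
  linear_combination hsum

end

/-- Finite order of the critical points, made quantitative by compactness. -/
theorem IsSmoothProfile.exists_bounds {D : CrossSection} {b : ℝ → ℝ} (hb : IsSmoothProfile D b)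
    {N : ℕ} (hN : ∀ y ∈ criticalPoints D b, ∃ n ≤ N, VanishesToOrder D b y n) :
    (∃ c > 0, ∀ y ∈ Icc (0 : ℝ) 1,
      c ^ 2 ≤ ∑ j ∈ Finset.range (N + 1), profileDeriv D b (j + 1) y ^ 2) ∧
    ∃ B ≥ 0, ∀ y ∈ Icc (0 : ℝ) 1, |profileDeriv D b (N + 2) y| ≤ B := by
  have cβ : ∀ j, ContinuousOn (profileDeriv D b j) (Icc 0 1) := fun j y hy =>
    (hb.hasDerivWithinAt j hy).continuousWithinAt
  constructor
  · have cs : ContinuousOn (fun y => ∑ j ∈ Finset.range (N + 1), profileDeriv D b (j + 1) y ^ 2)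
        (Icc 0 1) := continuousOn_finsetSum _ fun j _ => (cβ _).pow 2
    have hcell : ∀ y ∈ D.cell,
        0 < ∑ j ∈ Finset.range (N + 1), profileDeriv D b (j + 1) y ^ 2 := by
      intro y hy
      have hterm : ∀ n ≤ N, profileDeriv D b (n + 1) y ≠ 0 →
          0 < ∑ j ∈ Finset.range (N + 1), profileDeriv D b (j + 1) y ^ 2 := fun n hn h =>
        Finset.sum_pos' (fun _ _ => sq_nonneg _)
          ⟨n, Finset.mem_range.2 (by omega), by positivity⟩
      by_cases h1 : derivWithin b D.closure y = 0
      · obtain ⟨n, hn, hv⟩ := hN y ⟨hy, h1⟩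
        exact hterm n hn hv.2
      · exact hterm 0 (by omega) (by simpa [profileDeriv, iteratedDerivWithin_one] using h1)
    obtain ⟨y₀, hy₀, hmin⟩ := isCompact_Icc.exists_isMinOn (nonempty_Icc.2 zero_le_one) cs
    have hpos : 0 < ∑ j ∈ Finset.range (N + 1), profileDeriv D b (j + 1) y₀ ^ 2 := by
      cases D with
      | interval => exact hcell y₀ hy₀
      | torus =>
        rcases hy₀.2.eq_or_lt with h | h
        · -- the point `1` represents the same point of the torus as `0`
          have := hcell 0 (show (0 : ℝ) ∈ Ico 0 1 by simp)
          have e : ∀ j, profileDeriv .torus b j 1 = profileDeriv .torus b j 0 := fun j => by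
            simpa using hb.periodic_profileDeriv j 0
          simpa only [h, e] using this
        · exact hcell y₀ ⟨hy₀.1, h⟩
    refine ⟨_, Real.sqrt_pos.2 hpos, fun y hy => ?_⟩
    rw [Real.sq_sqrt hpos.le]
    exact hmin hy
  · obtain ⟨B, hB⟩ := isCompact_Icc.exists_bound_of_continuousOn (cβ (N + 2))
    exact ⟨|B|, abs_nonneg _, fun y hy => (hB y hy).trans (le_abs_self B)⟩

/-- A quantity that never increases and loses a factor `e` over every time span `T` decays
exponentially at rate `1 / T`. -/
theorem le_exp_mul_of_step {E : ℝ → ℝ} {T : ℝ} (hT : 0 < T) (h0 : ∀ t, 0 ≤ E t)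
    (hmono : ∀ {a b}, 0 < a → a ≤ b → E b ≤ E a)
    (hstep : ∀ {a}, 0 < a → E (a + T) ≤ Real.exp (-1) * E a) {s t : ℝ} (hs : 0 < s) (hst : s ≤ t) :
    E t ≤ Real.exp (1 - (t - s) / T) * E s := by
  have iter : ∀ n : ℕ, E (s + n * T) ≤ Real.exp (-n) * E s := by
    intro n
    induction n with
    | zero => simp
    | succ n ih =>
      have h1 := hstep (a := s + n * T) (by positivity)
      have h2 : s + ((n + 1 : ℕ) : ℝ) * T = s + n * T + T := by push_cast; ring
      have h3 : Real.exp (-((n + 1 : ℕ) : ℝ)) = Real.exp (-1) * Real.exp (-n) := by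
        rw [← Real.exp_add]; congr 1; push_cast; ring
      rw [h2, h3, mul_assoc]
      exact h1.trans (by gcongr)
  set n := ⌊(t - s) / T⌋₊ with hn
  have hfl : (n : ℝ) ≤ (t - s) / T := Nat.floor_le (div_nonneg (by linarith) hT.le)
  have hfl2 : (t - s) / T < n + 1 := Nat.lt_floor_add_one _
  have h1 : s + n * T ≤ t := by
    rw [le_div_iff₀ hT] at hfl
    linarith
  calc E t ≤ E (s + n * T) := hmono (by positivity) h1
    _ ≤ Real.exp (-n) * E s := iter n
    _ ≤ _ := by
      have := h0 s
      gcongr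
      linarith

/-! ### Decay of the solution -/

theorem one_le_abs_two_pi_mul {k : ℤ} (hk : k ≠ 0) : 1 ≤ |2 * Real.pi * k| := by
  have h1 : (1 : ℝ) ≤ |(k : ℝ)| := by exact_mod_cast Int.one_le_abs hk
  rw [abs_mul, abs_of_pos Real.two_pi_pos]
  nlinarith [Real.pi_gt_three]

/-- Exponential decay of every nonzero mode, at a rate which does not depend on the mode. -/
theorem IsSmoothProfile.exists_mode_decay {D : CrossSection} {b : ℝ → ℝ}
    (hb : IsSmoothProfile D b) {N : ℕ}
    (hN : ∀ y ∈ criticalPoints D b, ∃ n ≤ N, VanishesToOrder D b y n) :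
    ∃ ε > 0, ∀ (bc : BoundaryCondition D) (δ : ℝ) (f₀ : ℝ → ℝ → ℝ) (f : ℝ → ℝ → ℝ → ℝ),
      0 < δ → δ ≤ 1 → IsSolution bc b (δ ^ (N + 3)) f₀ f → ∀ k : ℤ, k ≠ 0 → ∀ s t, 0 < s → s ≤ t →
        ∫ y in (0 : ℝ)..1, ‖xMode (uncurry₃ f) k t y‖ ^ 2 ≤
          Real.exp (1 - (t - s) * (ε * δ ^ (N + 1) / 6)) *
            ∫ y in (0 : ℝ)..1, ‖xMode (uncurry₃ f) k s y‖ ^ 2 := by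
  obtain ⟨⟨c, hc, hlow⟩, B, hB, hup⟩ := hb.exists_bounds hN
  obtain ⟨ε, hε, H⟩ := exists_resolvent_estimate N hc hB
  refine ⟨ε, hε, fun bc δ f₀ f hδ hδ1 hf k hk s t hs hst => ?_⟩
  have hα := one_le_abs_two_pi_mul hk
  have hmode := hf.isModeSolution hb k
  have hν : 0 ≤ δ ^ (N + 3) := by positivity
  set q := ε * δ ^ (N + 1) with hq
  have hq0 : 0 < q := by positivity
  -- over a time `6 / q` the energy drops by a factor `10 / 36 < 1 / e`
  have hstep : ∀ {a : ℝ}, 0 < a →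
      ∫ y in (0 : ℝ)..1, ‖xMode (uncurry₃ f) k (a + 6 / q) y‖ ^ 2 ≤
        Real.exp (-1) * ∫ y in (0 : ℝ)..1, ‖xMode (uncurry₃ f) k a y‖ ^ 2 := by
    intro a ha
    have h := hmode.energy_decay (q := q) hν
      (fun h => by rw [h, abs_zero] at hα; linarith)
      (fun μ F F1 F2 G hF hF1 cF2 hbc heq => ?_) ha
      (lt_add_of_pos_right a (by positivity : 0 < 6 / q))
    · have e : q ^ 2 * (a + 6 / q - a) ^ 2 = 36 := by field_simp; norm_num
      rw [e] at h
      have h0 : 0 ≤ ∫ y in (0 : ℝ)..1, ‖xMode (uncurry₃ f) k a y‖ ^ 2 :=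
        intervalIntegral.integral_nonneg zero_le_one fun y _ => sq_nonneg _
      have he : (10 : ℝ) / 36 ≤ Real.exp (-1) := by
        rw [Real.exp_neg, div_le_iff₀ (by norm_num), inv_mul_eq_div, le_div_iff₀ (Real.exp_pos _)]
        linarith [Real.exp_one_lt_d9]
      have := mul_le_mul_of_nonneg_right he h0
      linarith
    · refine H (fun j y => profileDeriv D b j y - if j = 0 then μ else 0) δ _ F F1 F2 G
        (fun j y hy => ?_) (fun y hy => ?_) (fun y hy => ?_) hδ hδ1 hα hF hF1 cF2 ?_ (fun y hy => ?_)
      · simpa using (hb.hasDerivWithinAt j hy).sub_const (if j = 0 then μ else 0)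
      · simpa using hlow y hy
      · simpa using hup y hy
      · exact hbc.imp_right fun h => ⟨h.1, h.2.1, fun j => by simp only [h.2.2 j]⟩
      · simpa using heq y hy
  have h := le_exp_mul_of_step
    (E := fun t => ∫ y in (0 : ℝ)..1, ‖xMode (uncurry₃ f) k t y‖ ^ 2)
    (T := 6 / q) (by positivity)
    (fun t => intervalIntegral.integral_nonneg zero_le_one fun y _ => sq_nonneg _)
    (fun ha hab => hmode.energy_le hν ha hab) hstep hs hst
  rwa [div_div_eq_mul_div, mul_div_assoc] at h

theorem normL2_eq {h : ℝ → ℝ → ℝ}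
    (hh : ContinuousOn (fun p : ℝ × ℝ => h p.1 p.2) (Icc 0 1 ×ˢ Icc 0 1)) :
    normL2 h = ENNReal.ofReal √(∫ y in (0 : ℝ)..1, ∫ x in (0 : ℝ)..1, h x y ^ 2) := by
  have hsub : Ioo (0 : ℝ) 1 ×ˢ Ioo (0 : ℝ) 1 ⊆ Icc 0 1 ×ˢ Icc 0 1 :=
    prod_mono Ioo_subset_Icc_self Ioo_subset_Icc_self
  have hint : IntegrableOn (fun p : ℝ × ℝ => h p.1 p.2 ^ 2) (Ioo (0 : ℝ) 1 ×ˢ Ioo (0 : ℝ) 1) :=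
    ((hh.pow 2).integrableOn_compact (isCompact_Icc.prod isCompact_Icc)).mono_set hsub
  have hmem : MemLp (fun p : ℝ × ℝ => h p.1 p.2) 2 volΩ := by
    refine (memLp_two_iff_integrable_sq ((hh.mono hsub).aestronglyMeasurable
      (measurableSet_Ioo.prod measurableSet_Ioo))).2 hint
  rw [normL2, hmem.eLpNorm_eq_integral_rpow_norm (by norm_num) (by norm_num)]
  congr 1
  simp only [ENNReal.toReal_ofNat, Real.rpow_two, Real.norm_eq_abs, sq_abs]
  rw [← one_div, ← Real.sqrt_eq_rpow, ← intervalIntegral_swap_of_continuousOn zero_le_one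
    zero_le_one (h := fun x y => h x y ^ 2) (hh.pow 2)]
  congr 1
  rw [volΩ, Measure.volume_eq_prod] at *
  rw [setIntegral_prod _ hint]
  simp only [intervalIntegral.integral_of_le zero_le_one, integral_Ioc_eq_integral_Ioo]

theorem hasSum_mode_energy {h : ℝ → ℝ → ℝ}
    (hh : ContinuousOn (fun p : ℝ × ℝ => h p.1 p.2) (Icc 0 1 ×ˢ Icc 0 1)) :
    HasSum (fun k : ℤ => ∫ y in (0 : ℝ)..1,
        ‖weightedCoeff 0 1 (fun _ => 1) (fun x y => (h x y : ℂ)) k y‖ ^ 2)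
      (∫ y in (0 : ℝ)..1, ∫ x in (0 : ℝ)..1, h x y ^ 2) := by
  have e : ∀ (k : ℤ) (y : ℝ), fourierCoeffOn zero_lt_one (fun x => (h x y : ℂ)) k =
      weightedCoeff 0 1 (fun _ => 1) (fun x y => (h x y : ℂ)) k y := fun k y => by
    simpa using fourierCoeffOn_eq_weightedCoeff zero_lt_one (fun _ => 1)
      (fun x y => (h x y : ℂ)) k y
  have hs := hasSum_integral_sq_fourierCoeffOn (h := fun x y => (h x y : ℂ)) zero_lt_one
    (Complex.continuous_ofReal.comp_continuousOn hh)
  simp only [e] at hs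
  simpa using hs

section Solution

variable {D : CrossSection} {bc : BoundaryCondition D} {b : ℝ → ℝ} {ν : ℝ} {f₀ : ℝ → ℝ → ℝ}
  {f : ℝ → ℝ → ℝ → ℝ}

theorem IsSolution.continuousOn_square (hf : IsSolution bc b ν f₀ f) {t : ℝ} (ht : 0 < t) :
    ContinuousOn (fun p : ℝ × ℝ => f t p.1 p.2) (Icc 0 1 ×ˢ Icc 0 1) :=
  hf.smooth.continuousOn.comp (f := fun p : ℝ × ℝ => (t, p.1, p.2)) (by fun_prop)
    fun _ hp => ⟨ht, mem_univ _, D.Icc_subset_closure hp.2⟩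

theorem IsInitialDatum.continuousOn_square (h₀ : IsInitialDatum bc f₀) :
    ContinuousOn (fun p : ℝ × ℝ => f₀ p.1 p.2) (Icc 0 1 ×ˢ Icc 0 1) :=
  h₀.smooth.continuousOn.mono (prod_mono (subset_univ _) D.Icc_subset_closure)

/-- Parseval's identity in `x`. -/
theorem IsSolution.hasSum_xMode (hf : IsSolution bc b ν f₀ f) {t : ℝ} (ht : 0 < t) :
    HasSum (fun k : ℤ => ∫ y in (0 : ℝ)..1, ‖xMode (uncurry₃ f) k t y‖ ^ 2)
      (∫ y in (0 : ℝ)..1, ∫ x in (0 : ℝ)..1, f t x y ^ 2) :=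
  hasSum_mode_energy (hf.continuousOn_square ht)

theorem IsSolution.tendsto_normL2_sub (hf : IsSolution bc b ν f₀ f) :
    Tendsto (fun s => normL2 (fun x y => f s x y - f 0 x y)) (𝓝[>] 0) (𝓝 0) :=
  (hf.continuous_L2 0 le_rfl).mono_left (nhdsWithin_mono _ Ioi_subset_Ici_self)

theorem IsSolution.normL2_zero (hf : IsSolution bc b ν f₀ f) : normL2 (f 0) = normL2 f₀ :=
  eLpNorm_congr_ae hf.initial

theorem IsSolution.normL2_sub_zero (hf : IsSolution bc b ν f₀ f) (s : ℝ) :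
    normL2 (fun x y => f s x y - f 0 x y) = normL2 (fun x y => f s x y - f₀ x y) :=
  eLpNorm_congr_ae (hf.initial.mono fun p hp => by simp only [hp])

/-- The `x`-average vanishes for all times: its energy is nonincreasing, and it starts from `0`. -/
theorem IsSolution.integral_xMode_zero (hb : IsSmoothProfile D b) (hν : 0 ≤ ν)
    (h₀ : IsInitialDatum bc f₀) (hf : IsSolution bc b ν f₀ f) {t : ℝ} (ht : 0 < t) :
    ∫ y in (0 : ℝ)..1, ‖xMode (uncurry₃ f) 0 t y‖ ^ 2 = 0 := by
  have hbound : ∀ s, 0 < s → s ≤ t →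
      ENNReal.ofReal √(∫ y in (0 : ℝ)..1, ‖xMode (uncurry₃ f) 0 t y‖ ^ 2) ≤
        normL2 (fun x y => f s x y - f 0 x y) := by
    intro s hs hst
    have hc := (hf.continuousOn_square hs).sub h₀.continuousOn_square
    rw [hf.normL2_sub_zero, normL2_eq (h := fun x y => f s x y - f₀ x y) hc]
    refine ENNReal.ofReal_le_ofReal (Real.sqrt_le_sqrt ?_)
    refine ((hf.isModeSolution hb 0).energy_le hν hs hst).trans ?_
    refine le_trans (le_of_eq ?_) (le_hasSum
      (hasSum_mode_energy (h := fun x y => f s x y - f₀ x y) hc) 0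
      fun k _ => intervalIntegral.integral_nonneg zero_le_one fun y _ => sq_nonneg _)
    refine intervalIntegral.integral_congr fun y hy => ?_
    rw [uIcc_of_le zero_le_one] at hy
    have i1 : IntervalIntegrable (fun x => (f s x y : ℂ)) volume 0 1 :=
      intervalIntegrable_of_continuousOn (Complex.continuous_ofReal.comp_continuousOn
        (continuousOn_slice_left (h := f s) (hf.continuousOn_square hs) hy))
    have i0 : IntervalIntegrable (fun x => (f₀ x y : ℂ)) volume 0 1 :=
      intervalIntegrable_of_continuousOn (Complex.continuous_ofReal.comp_continuousOn
        (continuousOn_slice_left (h := f₀) h₀.continuousOn_square hy))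
    have hz : ∫ x in (0 : ℝ)..1, (f₀ x y : ℂ) = 0 := by
      rw [intervalIntegral.integral_ofReal, h₀.mean_zero y (D.Icc_subset_closure hy),
        Complex.ofReal_zero]
    simp only [xMode, weightedCoeff, uncurry₃, neg_zero, fourier_zero, Complex.ofReal_one, one_mul,
      Complex.ofReal_sub]
    rw [intervalIntegral.integral_sub i1 i0, hz, sub_zero]
  have hlim : ENNReal.ofReal √(∫ y in (0 : ℝ)..1, ‖xMode (uncurry₃ f) 0 t y‖ ^ 2) ≤ 0 := by
    refine ge_of_tendsto hf.tendsto_normL2_sub ?_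
    filter_upwards [Ioc_mem_nhdsGT ht] with s hs
    exact hbound s hs.1 hs.2
  have h0 : 0 ≤ ∫ y in (0 : ℝ)..1, ‖xMode (uncurry₃ f) 0 t y‖ ^ 2 :=
    intervalIntegral.integral_nonneg zero_le_one fun y _ => sq_nonneg _
  have h1 := ENNReal.ofReal_eq_zero.1 (le_antisymm hlim bot_le)
  exact le_antisymm (Real.sqrt_eq_zero'.1 (le_antisymm h1 (Real.sqrt_nonneg _))) h0

/-- Exponential decay of all nonzero modes from every positive time passes to the solution. -/
theorem IsSolution.normL2_le_of_mode_decay (hb : IsSmoothProfile D b) (hν : 0 ≤ ν)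
    (h₀ : IsInitialDatum bc f₀) (hf : IsSolution bc b ν f₀ f) {ρ : ℝ}
    (hdecay : ∀ k : ℤ, k ≠ 0 → ∀ s t, 0 < s → s ≤ t →
      ∫ y in (0 : ℝ)..1, ‖xMode (uncurry₃ f) k t y‖ ^ 2 ≤
        Real.exp (1 - (t - s) * ρ) * ∫ y in (0 : ℝ)..1, ‖xMode (uncurry₃ f) k s y‖ ^ 2)
    {t : ℝ} (ht : 0 < t) :
    normL2 (f t) ≤ ENNReal.ofReal (Real.exp ((1 - t * ρ) / 2)) * normL2 f₀ := by
  have hpos : ∀ s, 0 < s → s ≤ t →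
      normL2 (f t) ≤ ENNReal.ofReal (Real.exp ((1 - (t - s) * ρ) / 2)) * normL2 (f s) := by
    intro s hs hst
    rw [normL2_eq (hf.continuousOn_square ht), normL2_eq (hf.continuousOn_square hs),
      ← ENNReal.ofReal_mul (Real.exp_pos _).le, Real.exp_half, ← Real.sqrt_mul (Real.exp_pos _).le]
    refine ENNReal.ofReal_le_ofReal (Real.sqrt_le_sqrt ?_)
    refine hasSum_le (fun k => ?_) (hf.hasSum_xMode ht) ((hf.hasSum_xMode hs).mul_left _)
    rcases eq_or_ne k 0 with rfl | hk
    · rw [hf.integral_xMode_zero hb hν h₀ ht, hf.integral_xMode_zero hb hν h₀ hs, mul_zero]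
    · exact hdecay k hk s t hs hst
  have htri : ∀ s, 0 < s → normL2 (f s) ≤
      normL2 (fun x y => f s x y - f 0 x y) + normL2 (f 0) := by
    intro s hs
    have h1 := (hf.memLp s hs.le).aestronglyMeasurable
    have h2 := (hf.memLp 0 le_rfl).aestronglyMeasurable
    have h3 := eLpNorm_add_le (h1.sub h2) h2 one_le_two
    rwa [sub_add_cancel] at h3
  rw [← hf.normL2_zero]
  have hfin : normL2 (f 0) ≠ ⊤ := (hf.memLp 0 le_rfl).2.ne
  have hexp : Tendsto (fun s => ENNReal.ofReal (Real.exp ((1 - (t - s) * ρ) / 2))) (𝓝[>] 0)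
      (𝓝 (ENNReal.ofReal (Real.exp ((1 - t * ρ) / 2)))) := by
    refine (ENNReal.continuous_ofReal.tendsto _).comp (Tendsto.mono_left ?_ nhdsWithin_le_nhds)
    have : Continuous fun s : ℝ => Real.exp ((1 - (t - s) * ρ) / 2) := by fun_prop
    simpa using this.tendsto 0
  have hsum : Tendsto (fun s => normL2 (fun x y => f s x y - f 0 x y) + normL2 (f 0)) (𝓝[>] 0)
      (𝓝 (normL2 (f 0))) := by
    simpa using hf.tendsto_normL2_sub.add_const (normL2 (f 0))
  refine ge_of_tendsto (ENNReal.Tendsto.mul hexp (Or.inr hfin) hsum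
    (Or.inr ENNReal.ofReal_ne_top)) ?_
  filter_upwards [Ioc_mem_nhdsGT ht] with s hs
  exact (hpos s hs.1 hs.2).trans (by gcongr; exact htri s hs.1)

end Solution

end ShearFlow

theorem theorem1 (D : ShearFlow.CrossSection) (b : ℝ → ℝ)
    (hb : ShearFlow.IsSmoothProfile D b)
    -- the `M` distinct critical points `c i` of `b`, and the order of vanishing `n i` at each
    (M : ℕ) (c : Fin M → ℝ) (hc : Function.Injective c)
    (hcrit : Set.range c = ShearFlow.criticalPoints D b)
    (n : Fin M → ℕ) (hn : ∀ i, ShearFlow.VanishesToOrder D b (c i) (n i))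
    -- `N` is their maximum, and `N = 0` when `M = 0`
    (N : ℕ) (hN : N = Finset.univ.sup n) :
    ∃ d₀ > (0 : ℝ), ∃ ν₀ > (0 : ℝ), ∃ C > (1 : ℝ),
      ∀ (bc : ShearFlow.BoundaryCondition D) (ν : ℝ), 0 < ν → ν < ν₀ →
        ∀ (f_in : ℝ → ℝ → ℝ) (f : ℝ → ℝ → ℝ → ℝ),
          ShearFlow.IsInitialDatum bc f_in → ShearFlow.IsSolution bc b ν f_in f →
            ∀ t > (0 : ℝ),
              ShearFlow.normL2 (f t) ≤
                ENNReal.ofReal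
                    (C * Real.exp (-(d₀ * ν ^ (((N : ℝ) + 1) / ((N : ℝ) + 3)) * t))) *
                  ShearFlow.normL2 f_in := by
  have hN' : ∀ y ∈ ShearFlow.criticalPoints D b,
      ∃ m ≤ N, ShearFlow.VanishesToOrder D b y m := by
    intro y hy
    rw [← hcrit] at hy
    obtain ⟨i, rfl⟩ := hy
    exact ⟨n i, hN ▸ Finset.le_sup (Finset.mem_univ i), hn i⟩
  obtain ⟨ε, hε, H⟩ := hb.exists_mode_decay hN'
  refine ⟨ε / 12, by positivity, 1, one_pos, Real.exp (1 / 2),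
    Real.one_lt_exp_iff.2 (by norm_num), ?_⟩
  intro bc ν hν hν1 f_in f h₀ hf t ht
  set δ : ℝ := ν ^ (1 / ((N : ℝ) + 3)) with hδ
  have hδ0 : 0 < δ := Real.rpow_pos_of_pos hν _
  have hδ1 : δ ≤ 1 := Real.rpow_le_one hν.le hν1.le (by positivity)
  have hpow : ∀ m : ℕ, δ ^ m = ν ^ ((m : ℝ) / ((N : ℝ) + 3)) := fun m => by
    rw [hδ, ← Real.rpow_natCast, ← Real.rpow_mul hν.le]
    congr 1
    ring
  have hδν : δ ^ (N + 3) = ν := by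
    rw [hpow]
    push_cast
    rw [div_self (by positivity), Real.rpow_one]
  have hδr : δ ^ (N + 1) = ν ^ (((N : ℝ) + 1) / ((N : ℝ) + 3)) := by
    rw [hpow]
    push_cast
    rfl
  have hf' := hf
  rw [← hδν] at hf'
  have h := hf.normL2_le_of_mode_decay hb hν.le h₀ (H bc δ f_in f hδ0 hδ1 hf') ht
  rw [hδr] at h
  convert h using 3
  rw [← Real.exp_add]
  congr 1
  ring
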